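/- A rooted plane multi-edge tree is defined recursively: it consists of a root and an ordered (possibly empty) finite sequence of branches, each of which is again a rooted plane multi-edge tree and whose root is joined to the root of the whole tree by a positive number of parallel edges. There are only finitely many such trees with $n$ edges (counted with multiplicity). Let $V_n$ be the number of vertices of a uniformly random rooted plane multi-edge tree with $n$ edges. Then, as $n\to\infty$, \[ \mathbb{E}(V_n)=\frac45 n+\frac9{10}+O\Bigl(\frac1n\Bigr),\qquad \mathbb{V}(V_n)=\frac4{25}n+\frac2{25}+O\Bigl(\frac1n\Bigr), \] and \[ \mathbb{P}\left(\frac{V_n-\frac45 n}{\frac25\sqrt n}\le v\right)=\frac1{\sqrt{2\pi}}\int_{-\infty}^v e^{-t^2/2}\,dt+O\Bigl(\frac1{\sqrt n}\Bigr) \] uniformly for $v\in\mathbb{R}$, i.e. there is a constant $C$ such that for all $n\ge1$ and all $v\in\mathbb{R}$ the two sides without the error term differ by at most $C/\sqrt n$. Furthermore, for every sequence $k=k(n)$ of non-negative integers with $k=\frac{4n}{5}+o(n^{2/3})$, \[ \mathbb{P}(V_n=k)\sim\frac{5}{2\sqrt{2n\pi}}\exp\left(-\frac12\left(\frac{k-\frac45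 n}{\frac25\sqrt n}\right)^2\right)\qquad(n\to\infty). \] -/

import Mathlib

open Filter Asymptotics MeasureTheory ProbabilityTheory

/-- A rooted plane multi-edge tree: a root together with an ordered sequence of `r ≥ 0` branches,
the `i`-th of which is attached to the root by `mult i ≥ 1` parallel edges. -/
inductive MultiEdgeTree : Type
  | node (r : ℕ) (mult : Fin r → ℕ+) (child : Fin r → MultiEdgeTree) : MultiEdgeTree

namespace MultiEdgeTree

/-- The number of edges, counted with multiplicity. This is the size of the tree. -/
def edges : MultiEdgeTree → ℕ
  | node _ mult child => ∑ i, ((mult i : ℕ) + edges (child i))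

/-- The number of vertices. -/
def vertices : MultiEdgeTree → ℕ
  | node _ _ child => 1 + ∑ i, vertices (child i)

instance : MeasurableSpace MultiEdgeTree := ⊤

instance : DiscreteMeasurableSpace MultiEdgeTree := ⟨fun _ => trivial⟩

/-- The set of rooted plane multi-edge trees with `n` edges. -/
def ofSize (n : ℕ) : Set MultiEdgeTree := {t | t.edges = n}

/-- The law of a uniformly random rooted plane multi-edge tree with `n` edges. -/
noncomputable def uniformTree (n : ℕ) : Measure MultiEdgeTree := uniformOn (ofSize n)

theorem finite_edges_le (n : ℕ) : {t : MultiEdgeTree | t.edges ≤ n}.Finite := by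
  induction n using Nat.strong_induction_on with
  | _ n ih =>
    have hS : {t : MultiEdgeTree | t.edges < n}.Finite := by
      cases n with
      | zero => simp
      | succ m => simpa [Nat.lt_succ_iff] using ih m (Nat.lt_succ_self m)
    have hM : {k : ℕ+ | (k : ℕ) ≤ n}.Finite :=
      (Set.finite_Iic n).preimage (f := fun k : ℕ+ => (k : ℕ)) PNat.coe_injective.injOn
    refine Set.Finite.subset (Set.Finite.biUnion (Finset.range (n + 1)).finite_toSet
      (t := fun r => (fun p : (Fin r → ℕ+) × (Fin r → MultiEdgeTree) => node r p.1 p.2) ''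
        ((Set.univ.pi fun _ => {k : ℕ+ | (k : ℕ) ≤ n}) ×ˢ
          (Set.univ.pi fun _ => {t : MultiEdgeTree | t.edges < n})))
      (fun r _ => ((Set.Finite.pi' fun _ => hM).subset ?_ |>.prod
        ((Set.Finite.pi' fun _ => hS).subset ?_)).image _)) ?_
    · intro f hf i
      exact hf i trivial
    · intro f hf i
      exact hf i trivial
    · rintro ⟨r, m, c⟩ ht
      have ht' : ∑ i, ((m i : ℕ) + edges (c i)) ≤ n := by
        simpa [edges] using ht
      have hi : ∀ i, (m i : ℕ) + edges (c i) ≤ n := fun i =>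
        (Finset.single_le_sum (f := fun i => (m i : ℕ) + edges (c i))
          (fun _ _ => Nat.zero_le _) (Finset.mem_univ i)).trans ht'
      have hr : r ≤ n := by
        refine le_trans ?_ ht'
        calc r = ∑ _i : Fin r, 1 := by simp
          _ ≤ _ := Finset.sum_le_sum fun i _ => by have := (m i).pos; omega
      refine Set.mem_biUnion (x := r) (by simp; omega) ⟨(m, c), ⟨?_, ?_⟩, rfl⟩
      · intro i _
        have := hi i
        simp only [Set.mem_ofPred_eq]
        omega
      · intro i _
        have := hi i
        have := (m i).pos
        simp only [Set.mem_ofPred_eq]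
        omega

theorem finite_ofSize (n : ℕ) : (ofSize n).Finite :=
  (finite_edges_le n).subset fun _ h => le_of_eq h

theorem nonempty_ofSize (n : ℕ) : (ofSize n).Nonempty := by
  cases n with
  | zero => exact ⟨node 0 Fin.elim0 Fin.elim0, by simp [ofSize, edges]⟩
  | succ m =>
    exact ⟨node 1 (fun _ => m.succPNat) (fun _ => node 0 Fin.elim0 Fin.elim0),
      by simp [ofSize, edges]⟩

instance (n : ℕ) : IsProbabilityMeasure (uniformTree n) :=
  isProbabilityMeasure_uniformOn (finite_ofSize n) (nonempty_ofSize n)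

end MultiEdgeTree

/-!
Let `V` be the number of vertices of a random tree with `n ≥ 1` edges. Splitting off the first
branch of the root shows that there are `catalan k * (n - 1).choose (k - 1)` trees with `n` edges
and `k + 1` vertices (`card_trees`): a plane tree with `k` edges together with a composition of `n`
into `k` multiplicities. Everything else follows from the resulting ratio of consecutive
probabilities of `K = V - 1` (`weight_succ`), which is a rational function of `k` and `n`.

Multiplying the ratio by a test function and summing gives a Stein identity (`expect_stein`). The
test functions `1` and `4 * y + 2` express the mean and the second moment of `K` through
`E[1 / (4 * K - 2)]`, and the test functions `1 / (y + 1)` and `1 / ((y + 1) * (y + 2))` show that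
this reciprocal moment is `5 / (16 * n) + O(1 / n ^ 2)`; this yields the expansions of mean and
variance. Powers of `K - 4 / 5 * n` as test functions bound its second and fourth moments by the
Gaussian orders `n` and `n ^ 2`.

For the limit theorems the logarithm of the ratio is expanded around the centre `4 / 5 * n` and
summed: within distance `n ^ (2 / 3)` of the centre, the probability of `K = k` is a constant times
`exp (-(25 / (8 * n)) * y ^ 2)`, where `y = k - 4 / 5 * n`, up to a factor
`exp (O((|y| + 1) / n + (|y| + 1) ^ 3 / n ^ 2))` (`abs_logRatio_sub_centre_le`). The integer part of
a Gaussian variable has the same local shape, and by the moment bounds the error terms sum to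
`O(1 / √n)`, as does the mass of both laws outside the window. As both laws have total mass `1`,
the unknown constant is determined up to a relative error `O(1 / √n)`, and the total variation
distance is `O(1 / √n)` (`abs_measureReal_sub_le_of_local`, `exists_local_comparison`). No
asymptotic formula for the Catalan numbers, binomial coefficients or the number of trees is needed.
The bound on the distribution functions and the local limit theorem are then immediate.
-/

/-! ### Counting trees by edges and vertices -/

namespace MultiEdgeTree

open Finset.HasAntidiagonal (antidiagonal)

/-- The tree consisting of its root alone. -/
def leaf : MultiEdgeTree := node 0 Fin.elim0 Fin.elim0

/-- The tree `t` with a new first branch `s`, attached to the root by `m` parallel edges. -/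
def cons (m : ℕ+) (s : MultiEdgeTree) : MultiEdgeTree → MultiEdgeTree
  | node r mult child => node (r + 1) (Fin.cons m mult) (Fin.cons s child)

@[simp] theorem edges_leaf : leaf.edges = 0 := by simp [leaf, edges]

@[simp] theorem vertices_leaf : leaf.vertices = 1 := by simp [leaf, vertices]

@[simp] theorem edges_cons (m : ℕ+) (s t : MultiEdgeTree) :
    (cons m s t).edges = m + s.edges + t.edges := by
  cases t
  simp [cons, edges, Fin.sum_univ_succ]

@[simp] theorem vertices_cons (m : ℕ+) (s t : MultiEdgeTree) :
    (cons m s t).vertices = s.vertices + t.vertices := by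
  cases t
  simp [cons, vertices, Fin.sum_univ_succ]
  omega

theorem eq_leaf_or_cons (t : MultiEdgeTree) : t = leaf ∨ ∃ m s t', t = cons m s t' := by
  obtain ⟨r, mult, child⟩ := t
  cases r with
  | zero =>
    left
    rw [leaf, Subsingleton.elim mult Fin.elim0, Subsingleton.elim child Fin.elim0]
  | succ r =>
    right
    refine ⟨mult 0, child 0, node r (Fin.tail mult) (Fin.tail child), ?_⟩
    simp [cons]

theorem cons_injective {m m' : ℕ+} {s s' t t' : MultiEdgeTree}
    (h : cons m s t = cons m' s' t') : m = m' ∧ s = s' ∧ t = t' := by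
  obtain ⟨r, mult, child⟩ := t
  obtain ⟨r', mult', child'⟩ := t'
  simp only [cons, node.injEq, Nat.add_right_cancel_iff] at h
  obtain ⟨rfl, h1, h2⟩ := h
  have h1 := eq_of_heq h1
  have h2 := eq_of_heq h2
  rw [Fin.cons_inj] at h1 h2
  simp [h1, h2]

theorem vertices_pos (t : MultiEdgeTree) : 0 < t.vertices := by
  cases t
  simp [vertices]

/-- The trees with `n` edges and `k + 1` vertices. -/
noncomputable def trees (n k : ℕ) : Finset MultiEdgeTree :=
  ((finite_ofSize n).inter_of_left {t | t.vertices = k + 1}).toFinset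

@[simp] theorem mem_trees {n k : ℕ} {t : MultiEdgeTree} :
    t ∈ trees n k ↔ t.edges = n ∧ t.vertices = k + 1 := by simp [trees, ofSize]

theorem card_trees_zero (n : ℕ) : (trees n 0).card = if n = 0 then 1 else 0 := by
  have key : ∀ t : MultiEdgeTree, t.vertices = 1 ↔ t = leaf := by
    intro t
    rcases eq_leaf_or_cons t with rfl | ⟨m, s, t', rfl⟩
    · simp
    · have h1 := vertices_pos s
      have h2 := vertices_pos t'
      constructor
      · intro h
        simp at h
        omega
      · intro h
        rw [h]
        simp
  split_ifs with h
  · subst h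
    rw [Finset.card_eq_one]
    refine ⟨leaf, ?_⟩
    ext t
    simp only [mem_trees, zero_add, key, Finset.mem_singleton]
    constructor
    · exact fun h => h.2
    · rintro rfl
      simp
  · rw [Finset.card_eq_zero, Finset.eq_empty_iff_forall_notMem]
    intro t ht
    simp only [mem_trees, zero_add, key] at ht
    obtain ⟨h1, rfl⟩ := ht
    simp at h1
    exact h h1.symm

/-- Removing the first branch of a tree that is not a leaf. -/
theorem card_trees_succ (n k : ℕ) :
    (trees n (k + 1)).card =
      ∑ ml ∈ antidiagonal n, (if ml.1 = 0 then 0 else 1) *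
        ∑ ij ∈ antidiagonal k, ∑ ab ∈ antidiagonal ml.2,
          (trees ab.1 ij.1).card * (trees ab.2 ij.2).card := by
  classical
  have h : (trees n (k + 1)).card =
      (((antidiagonal n).filter (fun ml => ml.1 ≠ 0)).sigma fun ml =>
        (antidiagonal k).sigma fun ij => (antidiagonal ml.2).sigma fun ab =>
          trees ab.1 ij.1 ×ˢ trees ab.2 ij.2).card := by
    symm
    refine Finset.card_bij (fun x _ => cons (Nat.toPNat' x.1.1) x.2.2.2.1 x.2.2.2.2) ?_ ?_ ?_
    · rintro ⟨⟨m, l⟩, ⟨i, j⟩, ⟨a, b⟩, s, t⟩ h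
      simp [-Nat.toPNat'_coe] at h ⊢
      have : (m.toPNat' : ℕ) = m := by simp [Nat.toPNat'_coe, Nat.pos_iff_ne_zero, h.1.2]
      omega
    · rintro ⟨⟨m, l⟩, ⟨i, j⟩, ⟨a, b⟩, s, t⟩ h ⟨⟨m', l'⟩, ⟨i', j'⟩, ⟨a', b'⟩, s', t'⟩ h' he
      simp at h h' he
      have h1 : (m.toPNat' : ℕ) = m := by simp [Nat.toPNat'_coe, Nat.pos_iff_ne_zero, h.1.2]
      have h2 : (m'.toPNat' : ℕ) = m' := by simp [Nat.toPNat'_coe, Nat.pos_iff_ne_zero, h'.1.2]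
      obtain ⟨e1, rfl, rfl⟩ := cons_injective he
      have e2 : m = m' := by rw [← h1, ← h2, e1]
      obtain ⟨rfl, rfl, rfl, rfl, rfl, rfl⟩ :
          m = m' ∧ l = l' ∧ i = i' ∧ j = j' ∧ a = a' ∧ b = b' := by omega
      rfl
    · intro t ht
      rcases eq_leaf_or_cons t with rfl | ⟨m, s, t', rfl⟩
      · simp at ht
      · simp at ht
        have h1 := vertices_pos s
        have h2 := vertices_pos t'
        refine ⟨⟨(m, s.edges + t'.edges), (s.vertices - 1, t'.vertices - 1),
          (s.edges, t'.edges), s, t'⟩, ?_, ?_⟩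
        · simp
          omega
        · simp
  rw [h]
  simp only [Finset.card_sigma, Finset.card_product, Finset.sum_filter]
  refine Finset.sum_congr rfl fun ml _ => ?_
  by_cases hm : ml.1 = 0 <;> simp [hm]

open PowerSeries in
/-- The generating function of the trees with `k + 1` vertices: each of the `k` bundles of parallel
edges contributes a factor `X / (1 - X)`. -/
theorem mk_card_trees (k : ℕ) :
    (PowerSeries.mk fun n => ((trees n k).card : ℤ)) =
      (catalan k : ℤ⟦X⟧) * (X * mk 1) ^ k := by
  have hB : (PowerSeries.mk fun m => if m = 0 then (0 : ℤ) else 1) = X * mk 1 := by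
    ext m
    cases m <;> simp [coeff_succ_X_mul]
  induction k using Nat.strong_induction_on with
  | _ k ih =>
    cases k with
    | zero =>
      ext n
      simp [card_trees_zero, coeff_one]
    | succ k =>
      have h1 : (PowerSeries.mk fun n => ((trees n (k + 1)).card : ℤ)) =
          (PowerSeries.mk fun m => if m = 0 then (0 : ℤ) else 1) *
          ∑ ij ∈ antidiagonal k, (PowerSeries.mk fun n => ((trees n ij.1).card : ℤ)) *
            (PowerSeries.mk fun n => ((trees n ij.2).card : ℤ)) := by
        ext n
        rw [coeff_mk, card_trees_succ, coeff_mul]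
        push_cast
        refine Finset.sum_congr rfl fun ml _ => ?_
        simp [coeff_mul]
      have h2 : ∀ ij ∈ antidiagonal k,
          (PowerSeries.mk fun n => ((trees n ij.1).card : ℤ)) *
            (PowerSeries.mk fun n => ((trees n ij.2).card : ℤ)) =
          ((catalan ij.1 * catalan ij.2 : ℕ) : ℤ⟦X⟧) * (X * mk 1) ^ k := by
        intro ij h
        rw [Finset.HasAntidiagonal.mem_antidiagonal] at h
        rw [ih _ (by omega), ih _ (by omega), ← h, pow_add]
        push_cast
        ring
      rw [h1, Finset.sum_congr rfl h2, ← Finset.sum_mul, hB, catalan_succ', pow_succ]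
      push_cast
      ring

/-- A tree with `k + 1` vertices and `n` edges is a plane tree with `k` edges together with a
composition of `n` into `k` parts. -/
theorem card_trees (n k : ℕ) :
    (trees (n + 1) (k + 1)).card = catalan (k + 1) * n.choose k := by
  have h := congrArg (PowerSeries.coeff (n + 1)) (mk_card_trees (k + 1))
  rw [PowerSeries.coeff_mk, mul_pow, PowerSeries.mk_one_pow_eq_mk_choose_add,
    ← map_natCast (PowerSeries.C (R := ℤ)), PowerSeries.coeff_C_mul,
    PowerSeries.coeff_X_pow_mul'] at h
  split_ifs at h with hk
  · rw [PowerSeries.coeff_mk, show k + (n + 1 - (k + 1)) = n by omega] at h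
    exact_mod_cast h
  · rw [Nat.choose_eq_zero_of_lt (by omega : n < k), mul_zero]
    simpa using h

end MultiEdgeTree

/-! ### The distribution of the number of vertices and its moments -/

namespace MultiEdgeTree

theorem vertices_mem_Icc {n : ℕ} (hn : 1 ≤ n) {t : MultiEdgeTree} (ht : t.edges = n) :
    t.vertices ∈ Finset.Icc 2 (n + 1) := by
  obtain ⟨m, rfl⟩ : ∃ m, n = m + 1 := ⟨n - 1, by omega⟩
  have hv := vertices_pos t
  have hmem : t ∈ trees (m + 1) (t.vertices - 1) := by
    rw [mem_trees]
    omega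
  have hpos := Finset.card_pos.mpr ⟨t, hmem⟩
  cases hk : t.vertices - 1 with
  | zero =>
    rw [hk, card_trees_zero] at hpos
    simp at hpos
  | succ k =>
    rw [hk, card_trees] at hpos
    have : k ≤ m := by
      by_contra h
      rw [Nat.choose_eq_zero_of_lt (by omega)] at hpos
      simp at hpos
    rw [Finset.mem_Icc]
    omega

/-- The probability that a uniformly random tree with `n` edges has `k + 1` vertices. -/
noncomputable def weight (n k : ℕ) : ℝ :=
  (uniformTree n).real {t | t.vertices = k + 1}

theorem weight_eq_card_div (n k : ℕ) :
    weight n k = (trees n k).card / (finite_ofSize n).toFinset.card := by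
  have h : ofSize n ∩ {t | t.vertices = k + 1} = (trees n k : Set MultiEdgeTree) := by
    ext t
    simp [ofSize]
  rw [weight, uniformTree, uniformOn, Measure.real, cond_apply (MeasurableSet.of_discrete), h,
    Measure.count_apply_finset, Measure.count_apply_finite _ (finite_ofSize n)]
  simp
  ring

theorem weight_nonneg (n k : ℕ) : 0 ≤ weight n k := measureReal_nonneg

theorem weight_pos {n k : ℕ} (hk : 1 ≤ k) (hkn : k ≤ n) : 0 < weight n k := by
  obtain ⟨n, rfl⟩ : ∃ m, n = m + 1 := ⟨n - 1, by omega⟩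
  obtain ⟨k, rfl⟩ : ∃ m, k = m + 1 := ⟨k - 1, by omega⟩
  have hc : 0 < catalan (k + 1) := by
    have h := succ_mul_catalan_eq_centralBinom (k + 1)
    have := Nat.centralBinom_pos (k + 1)
    by_contra h0
    rw [Nat.eq_zero_of_not_pos h0] at h
    omega
  have ht : 0 < (finite_ofSize (n + 1)).toFinset.card := by
    rw [Finset.card_pos]
    simpa using nonempty_ofSize (n + 1)
  have := Nat.choose_pos (by omega : k ≤ n)
  rw [weight_eq_card_div, card_trees]
  positivity

/-- The ratio of consecutive weights, from which the whole distribution is analysed. -/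
theorem weight_succ (n : ℕ) {k : ℕ} (hn : 1 ≤ n) (hk : 1 ≤ k) :
    weight n (k + 1) * (k * (k + 2)) = (4 * k + 2) * (n - k) * weight n k := by
  obtain ⟨n, rfl⟩ : ∃ m, n = m + 1 := ⟨n - 1, by omega⟩
  obtain ⟨k, rfl⟩ : ∃ m, k = m + 1 := ⟨k - 1, by omega⟩
  rw [weight_eq_card_div, weight_eq_card_div, card_trees, card_trees]
  have h1 : ((k : ℝ) + 3) * catalan (k + 2) = (4 * k + 6) * catalan (k + 1) := by
    have e1 := succ_mul_catalan_eq_centralBinom (k + 1)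
    have e2 := succ_mul_catalan_eq_centralBinom (k + 2)
    have e3 := Nat.succ_mul_centralBinom_succ (k + 1)
    rw [← e1, show k + 1 + 1 = k + 2 by rfl, ← e2] at e3
    have e4 : ((k : ℝ) + 2) * ((k + 3) * catalan (k + 2)) =
        (k + 2) * ((4 * k + 6) * catalan (k + 1)) := by
      have := congrArg (Nat.cast (R := ℝ)) e3
      push_cast at this
      linear_combination this
    exact mul_left_cancel₀ (by positivity) e4
  have h2 : (n.choose (k + 1) : ℝ) * (k + 1) = n.choose k * (n - k) := by
    rcases le_or_gt k n with h | h
    · have := congrArg (Nat.cast (R := ℝ)) (Nat.choose_succ_right_eq n k)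
      push_cast [Nat.cast_sub h] at this
      exact this
    · rw [Nat.choose_eq_zero_of_lt h, Nat.choose_eq_zero_of_lt (by omega)]
      simp
  push_cast
  linear_combination (1 / ((finite_ofSize (n + 1)).toFinset.card : ℝ)) *
    ((n.choose (k + 1) : ℝ) * (k + 1) * h1 + (4 * k + 6) * catalan (k + 1) * h2)

theorem integrable_uniformTree (n : ℕ) (f : MultiEdgeTree → ℝ) :
    Integrable f (uniformTree n) := by
  have h : uniformTree n = (uniformTree n).restrict (ofSize n) := by
    rw [Measure.restrict_eq_self_of_ae_mem]
    exact ae_cond_mem MeasurableSet.of_discrete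
  rw [h]
  exact IntegrableOn.of_finite (finite_ofSize n)

/-- The expectation of `f (V - 1)`, where `V` is the number of vertices of a uniformly random tree
with `n ≥ 1` edges, as a linear functional of `f`. -/
noncomputable def expect (n : ℕ) : (ℕ → ℝ) →ₗ[ℝ] ℝ :=
  ∑ k ∈ Finset.Icc 1 n, weight n k • LinearMap.proj k

theorem expect_apply (n : ℕ) (f : ℕ → ℝ) :
    expect n f = ∑ k ∈ Finset.Icc 1 n, weight n k * f k := by
  simp [expect]

theorem integral_vertices {n : ℕ} (hn : 1 ≤ n) (f : ℕ → ℝ) :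
    ∫ t, f t.vertices ∂uniformTree n = expect n fun k => f (k + 1) := by
  have hmeas : Measurable vertices := Measurable.of_discrete
  have hint : Integrable f ((uniformTree n).map vertices) := by
    rw [integrable_map_measure (by fun_prop) hmeas.aemeasurable]
    exact integrable_uniformTree n _
  have h : (uniformTree n).map vertices =
      ((uniformTree n).map vertices).restrict (Finset.Icc 2 (n + 1) : Finset ℕ) := by
    rw [Measure.restrict_eq_self_of_ae_mem]
    rw [ae_map_iff hmeas.aemeasurable MeasurableSet.of_discrete]
    have := ae_cond_mem (μ := Measure.count) (s := ofSize n) MeasurableSet.of_discrete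
    exact this.mono fun t ht => by exact_mod_cast vertices_mem_Icc hn ht
  rw [← integral_map (f := f) hmeas.aemeasurable (by fun_prop), h,
    setIntegral_finset _ hint.integrableOn, expect_apply]
  symm
  refine Finset.sum_bij (fun k _ => k + 1) ?_ ?_ ?_ ?_
  · simp
  · simp
  · intro b hb
    rw [Finset.mem_Icc] at hb
    exact ⟨b - 1, by rw [Finset.mem_Icc]; omega, by omega⟩
  · intro k _
    rw [map_measureReal_apply hmeas (by simp)]
    rfl

theorem expect_one {n : ℕ} (hn : 1 ≤ n) : expect n 1 = 1 := by
  have := integral_vertices hn fun _ => 1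
  simp only [integral_const, probReal_univ, smul_eq_mul, mul_one] at this
  exact this.symm

theorem expect_congr {n : ℕ} {f g : ℕ → ℝ} (h : ∀ k, 1 ≤ k → k ≤ n → f k = g k) :
    expect n f = expect n g := by
  rw [expect_apply, expect_apply]
  refine Finset.sum_congr rfl fun k hk => ?_
  rw [Finset.mem_Icc] at hk
  rw [h k hk.1 hk.2]

theorem expect_mono {n : ℕ} {f g : ℕ → ℝ} (h : ∀ k, 1 ≤ k → k ≤ n → f k ≤ g k) :
    expect n f ≤ expect n g := by
  rw [expect_apply, expect_apply]
  refine Finset.sum_le_sum fun k hk => ?_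
  rw [Finset.mem_Icc] at hk
  exact mul_le_mul_of_nonneg_left (h k hk.1 hk.2) (weight_nonneg n k)

/-- A discrete integration by parts (Stein identity) for the number of vertices: the ratio of
consecutive weights, multiplied by `h k / (4 * k + 2)` and summed over `k`. -/
theorem expect_stein {n : ℕ} (hn : 1 ≤ n) (h : ℝ → ℝ) :
    expect n (fun k => (n - k) * h k) =
      expect n fun k => (k / 4 + 1 / 8 - 3 / (4 * (4 * k - 2))) * h (k - 1) := by
  have hs : ∀ f : ℕ → ℝ, ∑ k ∈ Finset.Icc 1 n, f k = ∑ i ∈ Finset.range n, f (i + 1) := by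
    intro f
    rw [Finset.range_eq_Ico, Finset.sum_Ico_add' f 0 n 1]
    rfl
  -- both sides are the sum of `F` over `range (n + 1)`, whose first and last terms vanish
  set F : ℕ → ℝ := fun i => weight n (i + 1) * (i * (i + 2)) * (h i / (4 * i + 2)) with hF
  have h0 : F 0 = 0 := by simp [hF]
  have hFn : F n = 0 := by
    simp only [hF]
    rw [weight_succ n hn hn]
    simp
  have e := Finset.sum_range_succ F n
  rw [Finset.sum_range_succ' F n, h0, hFn, add_zero, add_zero] at e
  rw [expect_apply, expect_apply, hs, hs]
  convert! e using 1
  · refine Finset.sum_congr rfl fun i _ => ?_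
    have := weight_succ n (k := i + 1) hn (by omega)
    simp only [hF]
    rw [this]
    push_cast
    have : (4 * ((i : ℝ) + 1) + 2) ≠ 0 := by positivity
    field_simp
  · refine Finset.sum_congr rfl fun i _ => ?_
    simp only [hF]
    push_cast
    have : (4 * (i : ℝ) + 2) ≠ 0 := by positivity
    rw [show (i : ℝ) + 1 - 1 = i by ring, show 4 * ((i : ℝ) + 1) - 2 = 4 * i + 2 by ring]
    field_simp
    ring

theorem remainder_mem {k : ℕ} (hk : 1 ≤ k) :
    (1 / 8 - 3 / (4 * (4 * k - 2)) : ℝ) ∈ Set.Icc (-1 / 4) (1 / 8) := by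
  have hk : (1 : ℝ) ≤ k := by exact_mod_cast hk
  have h1 : 3 / (4 * (4 * k - 2)) ≤ (3 / 8 : ℝ) := by
    rw [div_le_div_iff₀ (by linarith) (by norm_num)]
    linarith
  have h2 : 0 ≤ 3 / (4 * (4 * k - 2) : ℝ) := div_nonneg (by norm_num) (by linarith)
  constructor <;> linarith

/-- The Stein identity for powers of the centred variable `X`, as a tool for moment bounds: the
remainder `c` in it takes values in a fixed interval, so a polynomial bound valid for all such `c`
may be integrated. -/
theorem expect_nonpos_of_stein {n : ℕ} (hn : 1 ≤ n) (p : ℕ) (g : ℝ → ℝ)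
    (hg : ∀ X c : ℝ, -1 / 4 ≤ c → c ≤ 1 / 8 →
      g X ≤ ((n : ℝ) / 5 + X / 4 + c) * (X - 1) ^ p - ((n : ℝ) / 5 - X) * X ^ p) :
    expect n (fun k => g (k - 4 / 5 * n)) ≤ 0 := by
  have h := sub_eq_zero.mpr (expect_stein hn (fun y => (y - 4 / 5 * n) ^ p)).symm
  rw [← map_sub] at h
  rw [← h]
  refine expect_mono fun k hk _ => ?_
  obtain ⟨h1, h2⟩ := remainder_mem hk
  refine (hg _ _ h1 h2).trans_eq ?_
  simp only [Pi.sub_apply]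
  ring

theorem expect_sq_le {n : ℕ} (hn : 1 ≤ n) :
    expect n (fun k => (k - 4 / 5 * n) ^ 2) ≤ n := by
  have h := expect_nonpos_of_stein hn 1 (fun X => X ^ 2 - (n / 5 + 3 / 8)) fun X c h1 h2 => by
    nlinarith [sq_nonneg (X - 1), sq_nonneg (X + 1),
      mul_nonneg (sub_nonneg.2 h1) (sq_nonneg (X + 1))]
  have e : (fun k : ℕ => ((k : ℝ) - 4 / 5 * n) ^ 2 - (n / 5 + 3 / 8)) =
      (fun k : ℕ => ((k : ℝ) - 4 / 5 * n) ^ 2) - ((n / 5 + 3 / 8 : ℝ)) • 1 := by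
    ext
    simp
  rw [e, map_sub, map_smul, expect_one hn, smul_eq_mul, mul_one] at h
  have : (1 : ℝ) ≤ n := by exact_mod_cast hn
  linarith

theorem expect_pow_four_le {n : ℕ} (hn : 1 ≤ n) :
    expect n (fun k => (k - 4 / 5 * n) ^ 4) ≤ 100 * n ^ 2 := by
  have hn' : (1 : ℝ) ≤ n := by exact_mod_cast hn
  have h := expect_nonpos_of_stein hn 3
    (fun X => X ^ 4 / 2 - (n * (X ^ 2 + 1) + 20 * (X ^ 2 + 1))) fun X c h1 h2 => by
    have h3 : |X ^ 3| ≤ X ^ 4 / 8 + 2 * X ^ 2 := by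
      rw [abs_le]
      constructor <;> nlinarith [sq_nonneg (X * (X - 4)), sq_nonneg (X * (X + 4))]
    have h4 : |c * (X - 1) ^ 3| ≤ 1 / 4 * (4 * |X ^ 3| + 4) := by
      rw [abs_mul]
      refine mul_le_mul (abs_le.2 ⟨by linarith, by linarith⟩) ?_ (abs_nonneg _) (by norm_num)
      have : |X - 1| ≤ |X| + 1 := (abs_sub _ _).trans (by simp)
      rw [abs_pow, abs_pow]
      refine (pow_le_pow_left₀ (abs_nonneg _) this 3).trans ?_
      nlinarith [mul_nonneg (add_nonneg (abs_nonneg X) zero_le_one) (sq_nonneg (|X| - 1))]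
    have h5 : (n : ℝ) * (3 * X ^ 2 - 3 * X + 1) / 5 ≤ n * (X ^ 2 + 1) := by
      nlinarith [mul_nonneg (zero_le_one.trans hn') (sq_nonneg (X + 1))]
    have h6 := abs_le.1 h4
    have h7 := abs_le.1 h3
    have h8 : (n / 5 + X / 4 + c) * (X - 1) ^ 3 - (n / 5 - X) * X ^ 3 = 5 / 4 * X ^ 4 -
      n * (3 * X ^ 2 - 3 * X + 1) / 5 - (3 * X ^ 3 - 3 * X ^ 2 + X) / 4 + c * (X - 1) ^ 3 := by ring
    rw [h8]
    nlinarith [sq_nonneg (X - 1), sq_nonneg (X + 1), sq_nonneg (X ^ 2)]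
  have e : (fun k : ℕ => ((k : ℝ) - 4 / 5 * n) ^ 4 / 2 -
      (n * (((k : ℝ) - 4 / 5 * n) ^ 2 + 1) + 20 * (((k : ℝ) - 4 / 5 * n) ^ 2 + 1))) =
      (1 / 2 : ℝ) • (fun k : ℕ => ((k : ℝ) - 4 / 5 * n) ^ 4) -
      ((n + 20 : ℝ) • (fun k : ℕ => ((k : ℝ) - 4 / 5 * n) ^ 2) + (n + 20 : ℝ) • 1) := by
    ext
    simp
    ring
  rw [e, map_sub, map_add, map_smul, map_smul, map_smul, expect_one hn] at h
  simp only [smul_eq_mul] at h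
  nlinarith [expect_sq_le hn, mul_le_mul_of_nonneg_left (expect_sq_le hn)
    (by linarith : (0 : ℝ) ≤ n + 20)]

/-- The reciprocal moment entering the mean and the variance. Reciprocals as test functions in the
Stein identity bound it without any concentration estimate. -/
theorem expect_inv_bounds {n : ℕ} (hn : 1 ≤ n) :
    0 ≤ expect n (fun k => 1 / (4 * k - 2)) ∧
    expect n (fun k => 1 / (4 * k - 2)) ≤ 2 / n ∧
    |n * expect n (fun k => 1 / (4 * k - 2)) - 5 / 16| ≤ 8 / n := by
  have hn' : (1 : ℝ) ≤ n := by exact_mod_cast hn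
  set R₁ := expect n fun k => 1 / (k + 1) with hR₁
  set R₂ := expect n fun k => 1 / ((k + 1) * (k + 2)) with hR₂
  set Q := expect n fun k => 1 / (4 * k - 2) with hQ
  have hcast : ∀ k : ℕ, 1 ≤ k → (1 : ℝ) ≤ k := fun k hk => by exact_mod_cast hk
  -- the Stein identity for `h y = 1 / (y + 1)`
  have s1 : (n + 1) * R₁ - 1 = expect n fun k =>
      (k / 4 + 1 / 8 - 3 / (4 * (4 * k - 2))) * (1 / k) := by
    have := expect_stein hn fun y => 1 / (y + 1)
    simp only [sub_add_cancel] at this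
    rw [← this, hR₁, ← smul_eq_mul, ← map_smul,
      show ∀ x : ℝ, x - 1 = x - expect n 1 by simp [expect_one hn], ← map_sub]
    refine expect_congr fun k _ _ => ?_
    have : (k : ℝ) + 1 ≠ 0 := by positivity
    simp
    field_simp
    ring
  have s1' : |(n + 1) * R₁ - 5 / 4| ≤ R₁ / 2 := by
    have e1 : (n + 1) * R₁ - 5 / 4 = expect n fun k =>
        (1 / 8 - 3 / (4 * (4 * k - 2))) * (1 / k) := by
      have : (n + 1) * R₁ - 5 / 4 = ((n + 1) * R₁ - 1) - (1 / 4 : ℝ) • expect n 1 := by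
        rw [expect_one hn]
        simp
        ring
      rw [this, s1, ← map_smul, ← map_sub]
      refine expect_congr fun k hk _ => ?_
      have := hcast k hk
      have : (k : ℝ) ≠ 0 := by positivity
      simp
      field_simp
      ring
    have e2 : R₁ / 2 = expect n ((1 / 2 : ℝ) • fun k : ℕ => 1 / ((k : ℝ) + 1)) := by
      rw [map_smul, smul_eq_mul]
      ring
    have hinv : ∀ k : ℕ, 1 ≤ k → 1 / (k : ℝ) ≤ 2 * (1 / (k + 1)) := fun k hk => by
      have := hcast k hk
      rw [mul_one_div, div_le_div_iff₀ (by linarith) (by linarith)]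
      linarith
    have hpos : ∀ k : ℕ, 1 ≤ k → 0 ≤ 1 / (k : ℝ) := fun k hk => by positivity
    rw [abs_le, e1, e2, ← map_neg]
    constructor <;> refine expect_mono fun k hk _ => ?_
    all_goals
      obtain ⟨h1, h2⟩ := remainder_mem hk
      have h3 := hinv k hk
      have h4 := hpos k hk
      simp only [Pi.smul_apply, Pi.neg_apply, smul_eq_mul]
      nlinarith
  have hR₁' : 0 ≤ R₁ ∧ R₁ ≤ 2 / n := by
    have h0 : 0 ≤ R₁ := by
      rw [hR₁, ← map_zero (expect n)]
      refine expect_mono fun k hk _ => ?_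
      simp only [Pi.zero_apply]
      positivity
    refine ⟨h0, ?_⟩
    rw [le_div_iff₀ (by linarith)]
    nlinarith [(abs_le.1 s1').2]
  -- the Stein identity for `h y = 1 / ((y + 1) * (y + 2))`
  have hR₂' : R₂ ≤ 3 / n ^ 2 := by
    have := expect_stein hn fun y => 1 / ((y + 1) * (y + 2))
    have e1 : (n : ℝ) * R₂ - R₁ ≤
        expect n fun k : ℕ => (n - k) * (1 / ((k + 1) * (k + 2) : ℝ)) := by
      rw [hR₁, hR₂, ← smul_eq_mul, ← map_smul, ← map_sub]
      refine expect_mono fun k _ _ => ?_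
      simp only [Pi.sub_apply, Pi.smul_apply, smul_eq_mul]
      have : (k : ℝ) * (1 / ((k + 1) * (k + 2))) ≤ 1 / (k + 1) := by
        rw [mul_one_div, div_le_div_iff₀ (by positivity) (by positivity)]
        nlinarith [(Nat.cast_nonneg k : (0 : ℝ) ≤ k)]
      linarith
    have e2 : (expect n fun k => ((k : ℝ) / 4 + 1 / 8 - 3 / (4 * (4 * k - 2))) *
        (1 / ((k - 1 + 1) * (k - 1 + 2)))) ≤ 3 / 8 * R₁ := by
      rw [hR₁, ← smul_eq_mul, ← map_smul]
      refine expect_mono fun k hk _ => ?_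
      have h0 := hcast k hk
      obtain ⟨h1, h2⟩ := remainder_mem hk
      simp only [Pi.smul_apply, smul_eq_mul]
      have h3 : (k : ℝ) / 4 + 1 / 8 - 3 / (4 * (4 * k - 2)) ≤ 3 / 8 * k := by linarith
      refine (mul_le_mul_of_nonneg_right h3 (by positivity)).trans_eq ?_
      rw [show (k : ℝ) - 1 + 2 = k + 1 by ring, sub_add_cancel]
      field_simp
    have h3 : n * R₂ ≤ 3 / n := by
      have : (3 : ℝ) / n = 3 / 2 * (2 / n) := by ring
      rw [this]
      linarith [hR₁'.1, hR₁'.2]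
    rw [le_div_iff₀ (by positivity)]
    rw [le_div_iff₀ (by positivity)] at h3
    linarith
  have hQ1 : 0 ≤ Q - R₁ / 4 ∧ Q - R₁ / 4 ≤ 9 / 4 * R₂ := by
    have e1 : Q - R₁ / 4 = expect n fun k => 6 / (4 * (k + 1) * (4 * k - 2)) := by
      rw [show R₁ / 4 = (1 / 4 : ℝ) • R₁ by simp; ring, hQ, hR₁, ← map_smul, ← map_sub]
      refine expect_congr fun k hk _ => ?_
      have h0 := hcast k hk
      have h1 : 4 * (k : ℝ) - 2 ≠ 0 := by linarith
      have h2 : (k : ℝ) + 1 ≠ 0 := by linarith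
      simp only [Pi.sub_apply, Pi.smul_apply, smul_eq_mul]
      field_simp
      ring
    rw [e1]
    constructor
    · rw [← map_zero (expect n)]
      refine expect_mono fun k hk _ => ?_
      have h0 := hcast k hk
      have h1 : 0 < 4 * (k : ℝ) - 2 := by linarith
      simp only [Pi.zero_apply]
      positivity
    · rw [hR₂, ← smul_eq_mul, ← map_smul]
      refine expect_mono fun k hk _ => ?_
      have h0 := hcast k hk
      have h1 : 0 < 4 * (k : ℝ) - 2 := by linarith
      simp only [Pi.smul_apply, smul_eq_mul]
      rw [mul_one_div, div_le_div_iff₀ (by positivity) (by positivity)]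
      nlinarith
  have hQ2 : Q ≤ R₁ := by
    refine expect_mono fun k hk _ => ?_
    have h0 := hcast k hk
    rw [div_le_div_iff₀ (by linarith) (by positivity)]
    linarith
  refine ⟨by linarith, by linarith, ?_⟩
  have h2n : n * R₂ ≤ 3 / n := by
    refine (mul_le_mul_of_nonneg_left hR₂' (by linarith)).trans_eq ?_
    field_simp
  have h3 : (8 : ℝ) / n = 4 * (2 / n) := by ring
  have h4 : (3 : ℝ) / n = 3 / 2 * (2 / n) := by ring
  obtain ⟨h5, h6⟩ := abs_le.1 s1'
  have h7 : 0 ≤ (n : ℝ) * (Q - R₁ / 4) := mul_nonneg (by linarith) hQ1.1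
  have h8 : (n : ℝ) * (Q - R₁ / 4) ≤ 9 / 4 * (n * R₂) := by
    nlinarith [mul_le_mul_of_nonneg_left hQ1.2 (by linarith : (0 : ℝ) ≤ n)]
  rw [abs_le]
  constructor <;> nlinarith [hR₁'.1, hR₁'.2]

theorem expect_id {n : ℕ} (hn : 1 ≤ n) :
    expect n (fun k => (k : ℝ)) =
      4 / 5 * n - 1 / 10 + 3 / 5 * expect n (fun k => 1 / (4 * k - 2)) := by
  have h := expect_stein hn fun _ => 1
  have e1 : (expect n fun k => ((n : ℝ) - k) * 1) = n - expect n (fun k => (k : ℝ)) := by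
    rw [show (n : ℝ) - expect n (fun k => (k : ℝ)) =
      (n : ℝ) • expect n 1 - expect n (fun k => (k : ℝ)) by rw [expect_one hn]; simp,
      ← map_smul, ← map_sub]
    refine expect_congr fun k _ _ => ?_
    simp
  have e2 : (expect n fun k => ((k : ℝ) / 4 + 1 / 8 - 3 / (4 * (4 * k - 2))) * 1) =
      (1 / 4 : ℝ) • expect n (fun k => (k : ℝ)) + (1 / 8 : ℝ) • expect n 1 -
        (3 / 4 : ℝ) • expect n (fun k => 1 / (4 * k - 2)) := by
    rw [← map_smul, ← map_smul, ← map_smul, ← map_add, ← map_sub]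
    refine expect_congr fun k hk _ => ?_
    have hk : (1 : ℝ) ≤ k := by exact_mod_cast hk
    have : 4 * (k : ℝ) - 2 ≠ 0 := by linarith
    simp
    field_simp
  rw [e1, e2, expect_one hn] at h
  simp only [smul_eq_mul] at h
  linarith

theorem expect_sq {n : ℕ} (hn : 1 ≤ n) :
    expect n (fun k => (k : ℝ) ^ 2) =
      ((4 * n - 2) * expect n (fun k => (k : ℝ)) + 2 * n + 1) / 5 := by
  have h := expect_stein hn fun y => 4 * y + 2
  have e1 : (expect n fun k => ((n : ℝ) - k) * (4 * k + 2)) =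
      (4 * n - 2 : ℝ) • expect n (fun k => (k : ℝ)) - (4 : ℝ) • expect n (fun k => (k : ℝ) ^ 2) +
        (2 * n : ℝ) • expect n 1 := by
    rw [← map_smul, ← map_smul, ← map_smul, ← map_sub, ← map_add]
    refine expect_congr fun k _ _ => ?_
    simp
    ring
  have e2 : (expect n fun k => ((k : ℝ) / 4 + 1 / 8 - 3 / (4 * (4 * k - 2))) * (4 * (k - 1) + 2)) =
      expect n (fun k => (k : ℝ) ^ 2) - expect n 1 := by
    rw [← map_sub]
    refine expect_congr fun k hk _ => ?_
    have hk : (1 : ℝ) ≤ k := by exact_mod_cast hk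
    have h3 : 3 / (4 * (4 * (k : ℝ) - 2)) * (4 * k - 2) = 3 / 4 := by
      have : 4 * (k : ℝ) - 2 ≠ 0 := by linarith
      field_simp
    simp only [Pi.sub_apply, Pi.one_apply]
    linear_combination -h3
  rw [e1, e2, expect_one hn] at h
  simp only [smul_eq_mul] at h
  linarith

theorem integral_vertices_bound {n : ℕ} (hn : 1 ≤ n) :
    |(∫ t, (t.vertices : ℝ) ∂uniformTree n) - (4 / 5 * n + 9 / 10)| ≤ 2 * (1 / n) := by
  have e : (expect n fun k => ((k + 1 : ℕ) : ℝ)) = expect n (fun k => (k : ℝ)) + 1 := by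
    rw [← expect_one hn, ← map_add]
    refine expect_congr fun k _ _ => ?_
    simp
  obtain ⟨h1, h2, -⟩ := expect_inv_bounds hn
  rw [integral_vertices hn (fun v => (v : ℝ)), e, expect_id hn, abs_le]
  have : (2 : ℝ) / n = 2 * (1 / n) := by ring
  rw [← this]
  constructor <;> linarith

theorem variance_vertices_bound {n : ℕ} (hn : 1 ≤ n) :
    |variance (fun t : MultiEdgeTree => (t.vertices : ℝ)) (uniformTree n) -
      (4 / 25 * n + 2 / 25)| ≤ 20 * (1 / n) := by
  have hn' : (1 : ℝ) ≤ n := by exact_mod_cast hn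
  have e1 : (expect n fun k => ((k + 1 : ℕ) : ℝ)) = expect n (fun k => (k : ℝ)) + 1 := by
    rw [← expect_one hn, ← map_add]
    refine expect_congr fun k _ _ => ?_
    simp
  have e2 : (expect n fun k => ((k + 1 : ℕ) : ℝ) ^ 2) =
      expect n (fun k => (k : ℝ) ^ 2) + (2 : ℝ) • expect n (fun k => (k : ℝ)) + expect n 1 := by
    rw [← map_smul, ← map_add, ← map_add]
    refine expect_congr fun k _ _ => ?_
    simp
    ring
  have hvar : variance (fun t : MultiEdgeTree => (t.vertices : ℝ)) (uniformTree n) =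
      expect n (fun k => (k : ℝ) ^ 2) - expect n (fun k => (k : ℝ)) ^ 2 := by
    have hL : MemLp (fun t : MultiEdgeTree => (t.vertices : ℝ)) 2 (uniformTree n) := by
      rw [memLp_two_iff_integrable_sq (Measurable.of_discrete).aestronglyMeasurable]
      exact integrable_uniformTree n _
    rw [variance_eq_sub hL, integral_vertices hn (fun v => (v : ℝ)), e1]
    simp only [Pi.pow_apply]
    rw [integral_vertices hn (fun v => (v : ℝ) ^ 2), e2, expect_one hn, smul_eq_mul]
    ring
  obtain ⟨h1, h2, h3⟩ := expect_inv_bounds hn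
  rw [hvar, expect_sq hn, expect_id hn]
  set Q := expect n fun k => 1 / (4 * (k : ℝ) - 2)
  have h4 : (8 : ℝ) / n = 8 * (1 / n) := by ring
  have h5 : (2 : ℝ) / n = 2 * (1 / n) := by ring
  have h6 : (1 : ℝ) / n ≤ 1 := by
    rw [div_le_one (by linarith)]
    exact hn'
  rw [h4, abs_le] at h3
  rw [h5] at h2
  have h7 : Q ^ 2 ≤ 2 * Q := by nlinarith
  rw [abs_le]
  constructor <;> nlinarith

end MultiEdgeTree

/-! ### Local comparison with the Gaussian profile -/

theorem abs_log_one_add_sub_le {t : ℝ} (ht : |t| ≤ 1 / 2) : |Real.log (1 + t) - t| ≤ 2 * t ^ 2 := by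
  have h := Real.abs_log_sub_add_sum_range_le (x := -t) (by rw [abs_neg]; linarith) 1
  simp only [Finset.sum_range_one, abs_neg, sub_neg_eq_add] at h
  norm_num at h
  rw [show Real.log (1 + t) - t = -t + Real.log (1 + t) by ring]
  refine h.trans ?_
  rw [div_le_iff₀ (by linarith)]
  nlinarith [sq_nonneg t]

theorem abs_exp_sub_one_le_mul_exp (x : ℝ) : |Real.exp x - 1| ≤ |x| * Real.exp |x| := by
  rw [abs_le]
  have h1 := Real.add_one_le_exp x
  have h2 := Real.add_one_le_exp (-x)
  have h3 := Real.exp_pos x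
  have h4 : Real.exp x * Real.exp (-x) = 1 := by rw [← Real.exp_add]; simp
  have h5 : Real.exp x ≤ Real.exp |x| := Real.exp_le_exp.2 (le_abs_self x)
  have h6 : 1 ≤ Real.exp |x| := Real.one_le_exp (abs_nonneg x)
  have h7 := abs_nonneg x
  constructor
  · nlinarith [neg_abs_le x]
  · have : Real.exp x - 1 ≤ x * Real.exp x := by nlinarith
    refine this.trans ?_
    nlinarith [le_abs_self x]

namespace MultiEdgeTree

/-- The logarithm of the ratio of the weights to the Gaussian profile
`exp (-(25 / (8 * n)) * (k - 4 / 5 * n) ^ 2)`. -/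
noncomputable def logRatio (n k : ℕ) : ℝ :=
  Real.log (weight n k) + 25 / (8 * n) * (k - 4 / 5 * n) ^ 2

theorem abs_logRatio_succ_sub_le {n k : ℕ} (hn : 10 ≤ n) (hk : |(k : ℝ) - 4 / 5 * n| ≤ n / 20) :
    |logRatio n (k + 1) - logRatio n k| ≤
      70 * (1 / n + ((k : ℝ) - 4 / 5 * n) ^ 2 / n ^ 2) := by
  have hn' : (10 : ℝ) ≤ n := by exact_mod_cast hn
  obtain ⟨hk1, hk2⟩ := abs_le.1 hk
  have hk0 : 0 < k := by
    have : (0 : ℝ) < k := by linarith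
    exact_mod_cast this
  have hkn : k < n := by
    have : (k : ℝ) < n := by linarith
    exact_mod_cast this
  set y : ℝ := k - 4 / 5 * n with hy
  have hky : (k : ℝ) = 4 / 5 * n + y := by rw [hy]; ring
  have hw := weight_succ n (k := k) (by omega) hk0
  have hw1 := weight_pos hk0 hkn.le
  have hw2 := weight_pos (k := k + 1) (by omega) hkn
  -- each linear factor in the ratio of consecutive weights is a constant times `1 + t`
  -- (the constants cancel, so only the four terms `log (1 + t)` remain)
  set t₁ : ℝ := (5 * y + 5 / 2) / (4 * n) with ht₁
  set t₂ : ℝ := -(5 * y) / n with ht₂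
  set t₃ : ℝ := 5 * y / (4 * n) with ht₃
  set t₄ : ℝ := (5 * y + 10) / (4 * n) with ht₄
  have b₁ : |t₁| ≤ 1 / 2 := by
    rw [abs_le, ht₁, le_div_iff₀ (by linarith), div_le_iff₀ (by linarith)]
    constructor <;> linarith
  have b₂ : |t₂| ≤ 1 / 2 := by
    rw [abs_le, ht₂, le_div_iff₀ (by linarith), div_le_iff₀ (by linarith)]
    constructor <;> linarith
  have b₃ : |t₃| ≤ 1 / 2 := by
    rw [abs_le, ht₃, le_div_iff₀ (by linarith), div_le_iff₀ (by linarith)]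
    constructor <;> linarith
  have b₄ : |t₄| ≤ 1 / 2 := by
    rw [abs_le, ht₄, le_div_iff₀ (by linarith), div_le_iff₀ (by linarith)]
    constructor <;> linarith
  have hpos : ∀ {t : ℝ}, |t| ≤ 1 / 2 → 0 < 1 + t := fun h => by linarith [(abs_le.1 h).1]
  have e : weight n (k + 1) * ((1 + t₃) * (1 + t₄)) = (1 + t₁) * (1 + t₂) * weight n k := by
    have h0 : (n : ℝ) ≠ 0 := by linarith
    have f₁ : 4 * (k : ℝ) + 2 = 16 / 5 * n * (1 + t₁) := by
      rw [hky, ht₁]; field_simp; ring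
    have f₂ : (n : ℝ) - k = 1 / 5 * n * (1 + t₂) := by
      rw [hky, ht₂]; field_simp; ring
    have f₃ : (k : ℝ) = 4 / 5 * n * (1 + t₃) := by
      rw [hky, ht₃]; field_simp
    have f₄ : (k : ℝ) + 2 = 4 / 5 * n * (1 + t₄) := by
      rw [hky, ht₄]; field_simp; ring
    have f₅ : (k : ℝ) * (k + 2) = 4 / 5 * n * (1 + t₃) * (4 / 5 * n * (1 + t₄)) := by
      rw [← f₃, ← f₄]
    rw [f₁, f₂, f₅] at hw
    have h1 : (16 / 25 * (n : ℝ) ^ 2) ≠ 0 := by positivity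
    refine mul_left_cancel₀ h1 ?_
    linear_combination hw
  have hlog := congrArg Real.log e
  rw [Real.log_mul hw2.ne' (mul_pos (hpos b₃) (hpos b₄)).ne', Real.log_mul (hpos b₃).ne'
    (hpos b₄).ne', Real.log_mul (mul_pos (hpos b₁) (hpos b₂)).ne' hw1.ne',
    Real.log_mul (hpos b₁).ne' (hpos b₂).ne'] at hlog
  have hlin : t₁ + t₂ - t₃ - t₄ + 25 / (8 * n) * ((y + 1) ^ 2 - y ^ 2) = 5 / 4 * (1 / n) := by
    have h0 : (n : ℝ) ≠ 0 := by linarith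
    rw [ht₁, ht₂, ht₃, ht₄]
    field_simp
    ring
  have hsq : 2 * (t₁ ^ 2 + t₂ ^ 2 + t₃ ^ 2 + t₄ ^ 2) ≤ 66 * (y ^ 2 / n ^ 2) + 28 * (1 / n) := by
    have h0 : (n : ℝ) ≠ 0 := by linarith
    have : 2 * (t₁ ^ 2 + t₂ ^ 2 + t₃ ^ 2 + t₄ ^ 2) =
        ((5 * y + 5 / 2) ^ 2 + (20 * y) ^ 2 + (5 * y) ^ 2 + (5 * y + 10) ^ 2) / (8 * n ^ 2) := by
      rw [ht₁, ht₂, ht₃, ht₄]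
      field_simp
      ring
    have h2 : 66 * (y ^ 2 / (n : ℝ) ^ 2) + 28 * (1 / n) =
        (528 * y ^ 2 + 224 * n) / (8 * n ^ 2) := by
      field_simp
      ring
    rw [this, h2]
    refine div_le_div_of_nonneg_right ?_ (by positivity)
    linarith [sq_nonneg (y - 5 / 4), sq_nonneg y]
  have hL : logRatio n (k + 1) - logRatio n k = Real.log (weight n (k + 1)) -
      Real.log (weight n k) + 25 / (8 * n) * ((y + 1) ^ 2 - y ^ 2) := by
    rw [logRatio, logRatio, hy]
    push_cast
    ring
  have a₁ := abs_le.1 (abs_log_one_add_sub_le b₁)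
  have a₂ := abs_le.1 (abs_log_one_add_sub_le b₂)
  have a₃ := abs_le.1 (abs_log_one_add_sub_le b₃)
  have a₄ := abs_le.1 (abs_log_one_add_sub_le b₄)
  have hn0 : 0 ≤ 1 / (n : ℝ) := by positivity
  have hy0 : 0 ≤ y ^ 2 / (n : ℝ) ^ 2 := by positivity
  rw [hL, abs_le]
  constructor <;> linarith [a₁.1, a₁.2, a₂.1, a₂.2, a₃.1, a₃.2, a₄.1, a₄.2]

/-- The size of the relative error in the local comparison with the Gaussian profile, at distance
`y` from the centre. -/
noncomputable def localError (n : ℕ) (y : ℝ) : ℝ := (|y| + 1) / n + (|y| + 1) ^ 3 / n ^ 2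

theorem localError_nonneg (n : ℕ) (y : ℝ) : 0 ≤ localError n y := by
  unfold localError
  positivity

/-- The integer part of the centre `4 / 5 * n`. -/
noncomputable def centre (n : ℕ) : ℕ := ⌊(4 / 5 * n : ℝ)⌋₊

/-- Summing the increments of `logRatio` from the centre to `k`. -/
theorem abs_logRatio_sub_centre_le {n k : ℕ} (hn : 20 ≤ n)
    (hk : |(k : ℝ) - 4 / 5 * n| ≤ n / 20) :
    |logRatio n k - logRatio n (centre n)| ≤ 70 * localError n (k - 4 / 5 * n) := by
  have hn' : (20 : ℝ) ≤ n := by exact_mod_cast hn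
  set y : ℝ := k - 4 / 5 * n with hy
  have hc1 : (centre n : ℝ) ≤ 4 / 5 * n := Nat.floor_le (by positivity)
  have hc2 : (4 / 5 * n : ℝ) < centre n + 1 := Nat.lt_floor_add_one _
  -- the increments of `logRatio` between the centre and `k` are uniformly bounded
  set D : ℝ := 70 * (1 / n + (|y| + 1) ^ 2 / n ^ 2) with hD
  have hD0 : 0 ≤ D := by positivity
  have hstep : ∀ i : ℕ, |(i : ℝ) - 4 / 5 * n| ≤ max |y| 1 →
      |logRatio n (i + 1) - logRatio n i| ≤ D := by
    intro i hi
    have h1 : max |y| 1 ≤ n / 20 := max_le hk (by linarith)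
    refine (abs_logRatio_succ_sub_le (by omega) (hi.trans h1)).trans ?_
    have h2 : ((i : ℝ) - 4 / 5 * n) ^ 2 ≤ (|y| + 1) ^ 2 := by
      rw [← sq_abs ((i : ℝ) - 4 / 5 * n)]
      refine pow_le_pow_left₀ (abs_nonneg _) (hi.trans (max_le ?_ ?_)) 2
      · linarith
      · linarith [abs_nonneg y]
    rw [hD]
    gcongr
  have hmain : |logRatio n k - logRatio n (centre n)| ≤ (|y| + 1) * D := by
    rcases le_total k (centre n) with h | h
    · have := dist_le_Ico_sum_of_dist_le (f := logRatio n) (d := fun _ => D) h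
        (fun {i} hi1 hi2 => by
          rw [Real.dist_eq, abs_sub_comm]
          refine hstep i (le_max_of_le_left ?_)
          have e1 : (k : ℝ) ≤ i := by exact_mod_cast hi1
          have e2 : (i : ℝ) + 1 ≤ centre n := by exact_mod_cast hi2
          rw [abs_of_nonpos (by linarith), hy, abs_of_nonpos (by linarith)]
          linarith)
      rw [Real.dist_eq] at this
      refine this.trans ?_
      simp only [Finset.sum_const, Nat.card_Ico, nsmul_eq_mul]
      refine mul_le_mul_of_nonneg_right ?_ hD0
      rw [Nat.cast_sub h]
      linarith [neg_abs_le y]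
    · have := dist_le_Ico_sum_of_dist_le (f := logRatio n) (d := fun _ => D) h
        (fun {i} hi1 hi2 => by
          rw [Real.dist_eq, abs_sub_comm]
          refine hstep i ?_
          have e1 : (centre n : ℝ) ≤ i := by exact_mod_cast hi1
          have e2 : (i : ℝ) + 1 ≤ k := by exact_mod_cast hi2
          rw [abs_le]
          have := le_max_left |y| 1
          have := le_max_right |y| 1
          have := le_abs_self y
          constructor <;> linarith)
      rw [Real.dist_eq, abs_sub_comm] at this
      refine this.trans ?_
      simp only [Finset.sum_const, Nat.card_Ico, nsmul_eq_mul]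
      refine mul_le_mul_of_nonneg_right ?_ hD0
      rw [Nat.cast_sub h]
      linarith [le_abs_self y]
  refine hmain.trans_eq ?_
  rw [hD, localError]
  ring

end MultiEdgeTree

/-- A measure with a local comparison `μ {k} ≈ A * ν {k}` on a window carrying almost all of the
mass is close to `ν` in total variation: the unknown constant `A` is forced to be close to `1`. -/
theorem abs_measureReal_sub_le_of_local {μ ν : Measure ℤ} [IsProbabilityMeasure μ]
    [IsProbabilityMeasure ν] {W : Finset ℤ} {A ε : ℝ} (hA : 0 ≤ A) (hε : ε ≤ 1 / 4)
    (hW : ∑ k ∈ W, |μ.real {k} - A * ν.real {k}| ≤ ε) (hμ : μ.real (W : Set ℤ)ᶜ ≤ ε)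
    (hν : ν.real (W : Set ℤ)ᶜ ≤ ε) :
    |A - 1| ≤ 4 * ε ∧ ∀ S : Set ℤ, |μ.real S - ν.real S| ≤ 7 * ε := by
  classical
  have hsub : ∀ T ⊆ W, |μ.real (T : Set ℤ) - A * ν.real (T : Set ℤ)| ≤ ε := by
    intro T hT
    rw [← sum_measureReal_singleton, ← sum_measureReal_singleton, Finset.mul_sum,
      ← Finset.sum_sub_distrib]
    refine (Finset.abs_sum_le_sum_abs _ _).trans (le_trans ?_ hW)
    exact Finset.sum_le_sum_of_subset_of_nonneg hT fun _ _ _ => abs_nonneg _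
  have hε0 : 0 ≤ ε := measureReal_nonneg.trans hμ
  rw [probReal_compl_eq_one_sub W.measurableSet] at hμ hν
  have h1 := abs_le.1 (hsub W subset_rfl)
  have hμ1 : μ.real (W : Set ℤ) ≤ 1 := measureReal_le_one
  have hν1 : ν.real (W : Set ℤ) ≤ 1 := measureReal_le_one
  have hA2 : A ≤ 2 := by nlinarith
  have hA1 : |A - 1| ≤ 4 * ε := by
    rw [abs_le]
    constructor <;> nlinarith
  refine ⟨hA1, fun S => ?_⟩
  set T := W.filter (· ∈ S) with hT
  have hTS : (T : Set ℤ) = S ∩ W := by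
    ext
    simp [hT, and_comm]
  have hdiff : ∀ ρ : Measure ℤ, IsProbabilityMeasure ρ → 1 - ρ.real (W : Set ℤ) ≤ ε →
      ρ.real (T : Set ℤ) ≤ ρ.real S ∧ ρ.real S ≤ ρ.real (T : Set ℤ) + ε := by
    intro ρ _ hρ
    rw [hTS]
    refine ⟨measureReal_mono Set.inter_subset_left, ?_⟩
    have := measureReal_inter_add_sdiff (μ := ρ) (s := S) W.measurableSet
    have h2 : ρ.real (S \ W) ≤ ρ.real (W : Set ℤ)ᶜ := measureReal_mono fun x hx => hx.2
    rw [probReal_compl_eq_one_sub W.measurableSet] at h2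
    linarith
  obtain ⟨d1, d2⟩ := hdiff μ inferInstance hμ
  obtain ⟨d3, d4⟩ := hdiff ν inferInstance hν
  have h2 := abs_le.1 (hsub T (Finset.filter_subset _ _))
  have hT1 : ν.real (T : Set ℤ) ≤ 1 := measureReal_le_one
  have hT0 : 0 ≤ ν.real (T : Set ℤ) := measureReal_nonneg
  obtain ⟨a1, a2⟩ := abs_le.1 hA1
  rw [abs_le]
  constructor <;> nlinarith

theorem gaussianReal_Ico_bounds {a b L U : ℝ} (hab : a ≤ b)
    (h : ∀ u ∈ Set.Ico a b, L ≤ gaussianPDFReal 0 1 u ∧ gaussianPDFReal 0 1 u ≤ U) :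
    L * (b - a) ≤ (gaussianReal 0 1).real (Set.Ico a b) ∧
      (gaussianReal 0 1).real (Set.Ico a b) ≤ U * (b - a) := by
  have hpdf := (integrable_gaussianPDFReal 0 1).integrableOn (s := Set.Ico a b)
  have hc : ∀ c : ℝ, ∫ _ in Set.Ico a b, c = c * (b - a) := fun c => by
    simp [hab, mul_comm]
  rw [Measure.real, gaussianReal_apply_eq_integral 0 one_ne_zero, ENNReal.toReal_ofReal
    (integral_nonneg fun u => gaussianPDFReal_nonneg _ _ _), ← hc L, ← hc U]
  constructor
  · exact setIntegral_mono_on (by simp) hpdf measurableSet_Ico fun u hu => (h u hu).1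
  · exact setIntegral_mono_on hpdf (by simp) measurableSet_Ico fun u hu => (h u hu).2

/-! ### Total variation distance to the discretized Gaussian law -/

namespace MultiEdgeTree

/-- The law of `V - 1`, where `V` is the number of vertices of a uniformly random tree with
`n` edges. -/
noncomputable def vertexLaw (n : ℕ) : Measure ℤ :=
  (uniformTree n).map fun t => (t.vertices : ℤ) - 1

/-- The law of the integer part of a Gaussian variable with mean `4 / 5 * n` and standard deviation
`2 / 5 * √n`. -/
noncomputable def latticeGaussian (n : ℕ) : Measure ℤ :=
  (gaussianReal 0 1).map fun u => ⌊4 / 5 * n + 2 / 5 * √n * u⌋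

theorem measurable_lattice (n : ℕ) :
    Measurable fun u : ℝ => ⌊4 / 5 * n + 2 / 5 * √n * u⌋ :=
  Int.measurable_floor.comp (by fun_prop)

instance (n : ℕ) : IsProbabilityMeasure (vertexLaw n) :=
  Measure.isProbabilityMeasure_map (Measurable.of_discrete).aemeasurable

instance (n : ℕ) : IsProbabilityMeasure (latticeGaussian n) :=
  Measure.isProbabilityMeasure_map (measurable_lattice n).aemeasurable

theorem vertexLaw_singleton (n k : ℕ) : (vertexLaw n).real {(k : ℤ)} = weight n k := by
  rw [vertexLaw, map_measureReal_apply Measurable.of_discrete (by simp), weight]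
  congr 1
  ext t
  simp only [Set.mem_preimage, Set.mem_singleton_iff, Set.mem_ofPred_eq]
  omega

/-- The integers in `[1, n]` at distance at most `n ^ (2 / 3)` from the centre `4 / 5 * n`. -/
noncomputable def window (n : ℕ) : Finset ℤ :=
  ((Finset.Icc 1 n).filter fun k : ℕ => |(k : ℝ) - 4 / 5 * n| ^ 3 ≤ n ^ 2).map Nat.castEmbedding

theorem abs_le_of_pow_three_le {n : ℕ} (hn : 8000 ≤ n) {y : ℝ} (hy : |y| ^ 3 ≤ (n : ℝ) ^ 2) :
    |y| ≤ n / 20 := by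
  have hn' : (8000 : ℝ) ≤ n := by exact_mod_cast hn
  refine le_of_pow_le_pow_left₀ three_ne_zero (by positivity) (hy.trans ?_)
  nlinarith [sq_nonneg (n : ℝ)]

theorem mem_window {n : ℕ} (hn : 8000 ≤ n) {k : ℤ} (hk : |(k : ℝ) - 4 / 5 * n| ^ 3 ≤ n ^ 2) :
    k ∈ window n := by
  have hn' : (8000 : ℝ) ≤ n := by exact_mod_cast hn
  obtain ⟨h1, h2⟩ := abs_le.1 (abs_le_of_pow_three_le hn hk)
  have h3 : (0 : ℝ) < (k : ℝ) := by linarith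
  have h4 : (k : ℝ) < n := by linarith
  obtain ⟨m, rfl⟩ := Int.eq_ofNat_of_zero_le (by exact_mod_cast h3.le : 0 ≤ k)
  have h5 : 0 < m := by exact_mod_cast h3
  have h6 : m < n := by exact_mod_cast h4
  simp only [window, Finset.mem_map, Finset.mem_filter, Finset.mem_Icc]
  exact ⟨m, ⟨⟨h5, h6.le⟩, by exact_mod_cast hk⟩, rfl⟩

/-- Outside the window, the fourth power of the distance to the centre exceeds `n ^ (5 / 2)`. -/
theorem sqrt_pow_five_le {n : ℕ} (hn : 1 ≤ n) {a : ℝ} (h : (n : ℝ) ^ 2 < a ^ 3) :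
    √(n : ℝ) ^ 5 ≤ a ^ 4 := by
  have hq : 1 ≤ √(n : ℝ) := Real.one_le_sqrt.2 (by exact_mod_cast hn)
  have hq2 : √(n : ℝ) ^ 2 = n := Real.sq_sqrt (by positivity)
  refine le_of_pow_le_pow_left₀ three_ne_zero (by positivity) ?_
  have h1 : ((n : ℝ) ^ 2) ^ 4 ≤ (a ^ 3) ^ 4 := pow_le_pow_left₀ (by positivity) h.le 4
  calc (√(n : ℝ) ^ 5) ^ 3 = √(n : ℝ) ^ 15 := by ring
    _ ≤ √(n : ℝ) ^ 16 := pow_le_pow_right₀ hq (by norm_num)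
    _ = (√(n : ℝ) ^ 2) ^ 8 := by ring
    _ = ((n : ℝ) ^ 2) ^ 4 := by rw [hq2]; ring
    _ ≤ (a ^ 3) ^ 4 := h1
    _ = (a ^ 4) ^ 3 := by ring

/-- Markov's inequality for the fourth power of the distance to the centre. -/
theorem vertexLaw_compl_window_le {n : ℕ} (hn : 1 ≤ n) :
    (vertexLaw n).real (window n : Set ℤ)ᶜ ≤ 100 / √(n : ℝ) := by
  have hn' : (1 : ℝ) ≤ n := by exact_mod_cast hn
  have hq : 0 < √(n : ℝ) := Real.sqrt_pos.2 (by linarith)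
  have hq2 : √(n : ℝ) ^ 2 = n := Real.sq_sqrt (by positivity)
  have h1 := expect_one hn
  rw [expect_apply, ← Finset.sum_filter_add_sum_filter_not _
    (fun k : ℕ => |(k : ℝ) - 4 / 5 * n| ^ 3 ≤ n ^ 2)] at h1
  have h2 : (vertexLaw n).real (window n : Set ℤ) =
      ∑ k ∈ (Finset.Icc 1 n).filter fun k : ℕ => |(k : ℝ) - 4 / 5 * n| ^ 3 ≤ n ^ 2,
        weight n k * (1 : ℕ → ℝ) k := by
    rw [← sum_measureReal_singleton, window, Finset.sum_map]
    refine Finset.sum_congr rfl fun k _ => ?_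
    simpa using vertexLaw_singleton n k
  rw [probReal_compl_eq_one_sub (window n).measurableSet, h2, ← h1, add_sub_cancel_left]
  have h3 := expect_pow_four_le hn
  rw [expect_apply, ← Finset.sum_filter_add_sum_filter_not _
    (fun k : ℕ => |(k : ℝ) - 4 / 5 * n| ^ 3 ≤ n ^ 2)] at h3
  have h4 : 0 ≤ ∑ k ∈ (Finset.Icc 1 n).filter fun k : ℕ => |(k : ℝ) - 4 / 5 * n| ^ 3 ≤ n ^ 2,
      weight n k * ((k : ℝ) - 4 / 5 * n) ^ 4 :=
    Finset.sum_nonneg fun k _ => mul_nonneg (weight_nonneg _ _) (by positivity)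
  have h5 : √(n : ℝ) ^ 5 * ∑ k ∈ (Finset.Icc 1 n).filter fun k : ℕ =>
        ¬ |(k : ℝ) - 4 / 5 * n| ^ 3 ≤ n ^ 2, weight n k * (1 : ℕ → ℝ) k ≤
      ∑ k ∈ (Finset.Icc 1 n).filter fun k : ℕ => ¬ |(k : ℝ) - 4 / 5 * n| ^ 3 ≤ n ^ 2,
        weight n k * ((k : ℝ) - 4 / 5 * n) ^ 4 := by
    rw [Finset.mul_sum]
    refine Finset.sum_le_sum fun k hk => ?_
    rw [Finset.mem_filter, not_le] at hk
    have := sqrt_pow_five_le hn hk.2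
    rw [Even.pow_abs (by decide)] at this
    simp only [Pi.one_apply, mul_one]
    nlinarith [weight_nonneg n k]
  have h6 : 100 * (n : ℝ) ^ 2 = √(n : ℝ) ^ 5 * (100 / √(n : ℝ)) := by
    nth_rewrite 1 [← hq2]
    field_simp
  refine le_of_mul_le_mul_left ?_ (by positivity : 0 < √(n : ℝ) ^ 5)
  linarith

/-- The local errors are summable against the law of `V - 1`: by the arithmetic-geometric mean
inequality they are dominated by second and fourth moments. -/
theorem expect_localError_le {n : ℕ} (hn : 1 ≤ n) :
    expect n (fun k => localError n (k - 4 / 5 * n)) ≤ 220 / √(n : ℝ) := by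
  have hn' : (1 : ℝ) ≤ n := by exact_mod_cast hn
  set q := √(n : ℝ) with hq
  have hq1 : 1 ≤ q := Real.one_le_sqrt.2 hn'
  have hq0 : 0 < q := by linarith
  have hq2 : (n : ℝ) = q ^ 2 := (Real.sq_sqrt (by positivity)).symm
  have hb : ∀ y : ℝ, localError n y ≤
      2 / q ^ 5 * y ^ 4 + (1 / (2 * q ^ 3) + 2 / q ^ 3) * y ^ 2 +
        (1 / (2 * q) + 1 / q ^ 2 + 4 / q ^ 4) := by
    intro y
    have h0 := abs_nonneg y
    have h1 : |y| ≤ (y ^ 2 / q + q) / 2 := by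
      rw [← sq_abs y]
      rw [div_add' _ _ _ hq0.ne', div_div, le_div_iff₀ (by positivity)]
      nlinarith [sq_nonneg (|y| - q)]
    have h2 : |y| ^ 3 ≤ (y ^ 4 / q + q * y ^ 2) / 2 := by
      have : |y| ^ 3 = |y| * y ^ 2 := by rw [← sq_abs y]; ring
      rw [this]
      refine (mul_le_mul_of_nonneg_right h1 (sq_nonneg y)).trans_eq ?_
      ring
    have h3 : (|y| + 1) ^ 3 ≤ 4 * (|y| ^ 3 + 1) := by
      nlinarith [mul_nonneg (add_nonneg h0 zero_le_one) (sq_nonneg (|y| - 1))]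
    have h4 : localError n y ≤ ((y ^ 2 / q + q) / 2 + 1) / q ^ 2 +
        4 * ((y ^ 4 / q + q * y ^ 2) / 2 + 1) / (q ^ 2) ^ 2 := by
      rw [localError, hq2]
      gcongr
      linarith
    refine h4.trans_eq ?_
    field_simp
    ring
  have e : (fun k : ℕ => 2 / q ^ 5 * ((k : ℝ) - 4 / 5 * n) ^ 4 +
      (1 / (2 * q ^ 3) + 2 / q ^ 3) * ((k : ℝ) - 4 / 5 * n) ^ 2 +
        (1 / (2 * q) + 1 / q ^ 2 + 4 / q ^ 4)) =
      (2 / q ^ 5) • (fun k : ℕ => ((k : ℝ) - 4 / 5 * n) ^ 4) +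
      (1 / (2 * q ^ 3) + 2 / q ^ 3) • (fun k : ℕ => ((k : ℝ) - 4 / 5 * n) ^ 2) +
      (1 / (2 * q) + 1 / q ^ 2 + 4 / q ^ 4) • 1 := by
    ext
    simp
  refine (expect_mono fun k _ _ => hb _).trans ?_
  rw [e, map_add, map_add, map_smul, map_smul, map_smul, expect_one hn]
  simp only [smul_eq_mul, mul_one]
  have h4 := mul_le_mul_of_nonneg_left (expect_pow_four_le hn)
    (by positivity : 0 ≤ 2 / q ^ 5)
  have h2 := mul_le_mul_of_nonneg_left (expect_sq_le hn)
    (by positivity : 0 ≤ 1 / (2 * q ^ 3) + 2 / q ^ 3)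
  have h4' : 2 / q ^ 5 * (100 * (n : ℝ) ^ 2) = 200 / q := by
    rw [hq2]; field_simp; norm_num
  have h2' : (1 / (2 * q ^ 3) + 2 / q ^ 3) * (n : ℝ) = 5 / 2 / q := by
    rw [hq2]; field_simp; norm_num
  have h1 : 1 / q ^ 2 ≤ 1 / q := by
    rw [div_le_div_iff₀ (by positivity) hq0]
    nlinarith
  have h3 : 4 / q ^ 4 ≤ 4 / q := by
    refine div_le_div_of_nonneg_left (by norm_num) hq0 ?_
    calc q = q ^ 1 := (pow_one q).symm
      _ ≤ q ^ 4 := pow_le_pow_right₀ hq1 (by norm_num)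
  have h5 : (220 : ℝ) / q = 200 / q + 5 / 2 / q + 1 / (2 * q) + 1 / q + 4 / q + 12 / q := by
    field_simp; norm_num
  have : 0 ≤ 12 / q := by positivity
  linarith

/-- The atoms of the discretized Gaussian law are within a factor `exp (± O((|y| + 1) / n))` of the
Gaussian profile. -/
theorem latticeGaussian_singleton_bounds {n : ℕ} (hn : 1 ≤ n) (k : ℤ) {y : ℝ}
    (hy : (k : ℝ) - 4 / 5 * n = y) :
    Real.exp (-(25 / (8 * n)) * y ^ 2 - 25 / (8 * n) * (2 * |y| + 1)) ≤
      √(2 * Real.pi) * (2 / 5 * √(n : ℝ)) * (latticeGaussian n).real {k} ∧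
    √(2 * Real.pi) * (2 / 5 * √(n : ℝ)) * (latticeGaussian n).real {k} ≤
      Real.exp (-(25 / (8 * n)) * y ^ 2 + 25 / (8 * n) * (2 * |y| + 1)) := by
  have hn' : (1 : ℝ) ≤ n := by exact_mod_cast hn
  set σ := 2 / 5 * √(n : ℝ) with hσ
  have hσ0 : 0 < σ := by
    have : 0 < √(n : ℝ) := Real.sqrt_pos.2 (by linarith)
    positivity
  have hσ2 : σ ^ 2 = 4 / 25 * n := by
    rw [hσ, mul_pow, Real.sq_sqrt (by positivity)]
    norm_num
  have hset : (fun u : ℝ => ⌊4 / 5 * n + 2 / 5 * √(n : ℝ) * u⌋) ⁻¹' {k} =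
      Set.Ico (y / σ) ((y + 1) / σ) := by
    ext u
    rw [Set.mem_preimage, Set.mem_singleton_iff, Int.floor_eq_iff, Set.mem_Ico,
      div_le_iff₀ hσ0, lt_div_iff₀ hσ0, ← hσ]
    constructor <;> rintro ⟨h1, h2⟩ <;> constructor <;> linarith
  have hpdf : ∀ u, gaussianPDFReal 0 1 u =
      (√(2 * Real.pi))⁻¹ * Real.exp (-(25 / (8 * n)) * (σ * u) ^ 2) := by
    intro u
    rw [gaussianPDFReal, mul_pow, hσ2]
    simp only [NNReal.coe_one, mul_one, sub_zero]
    congr 2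
    field_simp
    ring
  have hb := gaussianReal_Ico_bounds (a := y / σ) (b := (y + 1) / σ)
    (L := (√(2 * Real.pi))⁻¹ * Real.exp (-(25 / (8 * n)) * y ^ 2 - 25 / (8 * n) * (2 * |y| + 1)))
    (U := (√(2 * Real.pi))⁻¹ * Real.exp (-(25 / (8 * n)) * y ^ 2 + 25 / (8 * n) * (2 * |y| + 1)))
    (by gcongr; linarith) (fun u hu => by
      rw [Set.mem_Ico, div_le_iff₀ hσ0, lt_div_iff₀ hσ0] at hu
      have h1 : |(σ * u) ^ 2 - y ^ 2| ≤ 2 * |y| + 1 := by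
        have h2 : (σ * u) ^ 2 - y ^ 2 = 2 * y * (u * σ - y) + (u * σ - y) ^ 2 := by ring
        have h3 : 0 ≤ u * σ - y := by linarith
        have h4 : u * σ - y ≤ 1 := by linarith
        have h5 := neg_abs_le y
        have h6 := le_abs_self y
        rw [h2, abs_le]
        constructor <;> nlinarith [abs_nonneg y]
      obtain ⟨h2, h3⟩ := abs_le.1 h1
      have h4 : (0 : ℝ) ≤ 25 / (8 * n) := by positivity
      rw [hpdf]
      constructor
      · gcongr
        nlinarith
      · gcongr
        nlinarith)
  have hlen : (y + 1) / σ - y / σ = σ⁻¹ := by field_simp; ring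
  have hp : 0 < √(2 * Real.pi) := Real.sqrt_pos.2 (by positivity)
  rw [latticeGaussian, map_measureReal_apply (measurable_lattice n) (by simp), hset]
  rw [hlen] at hb
  have hc : ∀ E : ℝ, √(2 * Real.pi) * σ * ((√(2 * Real.pi))⁻¹ * E * σ⁻¹) = E := fun E => by
    field_simp
  constructor
  · rw [← hc (Real.exp _)]
    exact mul_le_mul_of_nonneg_left hb.1 (by positivity)
  · rw [← hc (Real.exp (_ + _))]
    exact mul_le_mul_of_nonneg_left hb.2 (by positivity)

/-- The factor between the law of the number of vertices and its Gaussian approximation, as seen at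
the centre. -/
noncomputable def amplitude (n : ℕ) : ℝ :=
  Real.exp (logRatio n (centre n)) * (√(2 * Real.pi) * (2 / 5 * √(n : ℝ)))

theorem amplitude_nonneg (n : ℕ) : 0 ≤ amplitude n := by
  unfold amplitude
  positivity

theorem weight_eq_exp {n k : ℕ} (hk : 1 ≤ k) (hkn : k ≤ n) :
    weight n k = Real.exp (logRatio n k - 25 / (8 * n) * (k - 4 / 5 * n) ^ 2) := by
  rw [logRatio, add_sub_cancel_right, Real.exp_log (weight_pos hk hkn)]

/-- The local comparison in additive form, valid throughout the window. -/
theorem abs_weight_sub_le {n k : ℕ} (hn : 8000 ≤ n) (hk : 1 ≤ k) (hkn : k ≤ n)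
    (h : |(k : ℝ) - 4 / 5 * n| ^ 3 ≤ n ^ 2) :
    |weight n k - amplitude n * (latticeGaussian n).real {(k : ℤ)}| ≤
      80 * Real.exp 800 * (weight n k * localError n (k - 4 / 5 * n)) := by
  have hn' : (8000 : ℝ) ≤ n := by exact_mod_cast hn
  obtain ⟨b1, b2⟩ := latticeGaussian_singleton_bounds (n := n) (by omega) (k : ℤ)
    (y := k - 4 / 5 * n) (by simp)
  have hy := abs_le_of_pow_three_le hn h
  have hL := abs_le.1 (abs_logRatio_sub_centre_le (by omega) hy)
  have hw := weight_eq_exp hk hkn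
  set y : ℝ := k - 4 / 5 * n
  set δ := localError n y with hδ
  have hy0 := abs_nonneg y
  have hn0 : (n : ℝ) ≠ 0 := by linarith
  have hδ0 : 0 ≤ δ := localError_nonneg _ _
  -- the choice of the window keeps the relative error bounded
  have hδ10 : δ ≤ 10 := by
    have h1 : (|y| + 1) / n ≤ 1 := by
      rw [div_le_one (by linarith)]
      linarith
    have h2 : (|y| + 1) ^ 3 / (n : ℝ) ^ 2 ≤ 8 := by
      rw [div_le_iff₀ (by positivity)]
      nlinarith [mul_nonneg (add_nonneg hy0 zero_le_one) (sq_nonneg (|y| - 1))]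
    rw [hδ, localError]
    linarith
  have hθ : 25 / (8 * n) * (2 * |y| + 1) ≤ 10 * δ := by
    have h1 : 25 / (8 * n) * (2 * |y| + 1) ≤ 10 * ((|y| + 1) / n) := by
      rw [div_mul_eq_mul_div, mul_div_assoc', div_le_div_iff₀ (by positivity) (by positivity)]
      nlinarith
    have h2 : 0 ≤ (|y| + 1) ^ 3 / (n : ℝ) ^ 2 := by positivity
    rw [hδ, localError]
    linarith
  have hw0 : 0 ≤ weight n k := weight_nonneg n k
  have hup : amplitude n * (latticeGaussian n).real {(k : ℤ)} ≤
      weight n k * Real.exp (80 * δ) := by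
    rw [amplitude, mul_assoc, hw, ← Real.exp_add]
    refine (mul_le_mul_of_nonneg_left b2 (Real.exp_pos _).le).trans ?_
    rw [← Real.exp_add]
    refine Real.exp_le_exp.2 ?_
    linarith
  have hlow : weight n k * Real.exp (-(80 * δ)) ≤
      amplitude n * (latticeGaussian n).real {(k : ℤ)} := by
    rw [amplitude, mul_assoc, hw, ← Real.exp_add]
    refine le_trans ?_ (mul_le_mul_of_nonneg_left b1 (Real.exp_pos _).le)
    rw [← Real.exp_add]
    refine Real.exp_le_exp.2 ?_
    linarith
  have hE : ∀ s : ℝ, |s| = 80 * δ → |Real.exp s - 1| ≤ 80 * δ * Real.exp 800 := fun s hs => by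
    refine (abs_exp_sub_one_le_mul_exp s).trans ?_
    rw [hs]
    gcongr
    linarith
  have e1 := abs_le.1 (hE (80 * δ) (abs_of_nonneg (by positivity)))
  have e2 := abs_le.1 (hE (-(80 * δ)) (by rw [abs_neg, abs_of_nonneg (by positivity)]))
  have e3 := mul_le_mul_of_nonneg_left e1.2 hw0
  have e4 := mul_le_mul_of_nonneg_left e2.1 hw0
  rw [abs_le]
  constructor <;> linarith

/-- The fourth moment of the standard Gaussian law. -/
noncomputable def fourthMoment : ℝ := ∫ u, u ^ 4 ∂gaussianReal 0 1

/-- Markov's inequality for the fourth power: outside the window the standard Gaussian variable `u`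
satisfies `√n ≤ u ^ 4`. -/
theorem latticeGaussian_compl_window_le {n : ℕ} (hn : 8000 ≤ n) :
    (latticeGaussian n).real (window n : Set ℤ)ᶜ ≤ fourthMoment / √(n : ℝ) := by
  have hn' : (8000 : ℝ) ≤ n := by exact_mod_cast hn
  set q := √(n : ℝ) with hq
  have hq0 : 0 < q := Real.sqrt_pos.2 (by linarith)
  have hq2 : q ^ 2 = n := Real.sq_sqrt (by positivity)
  have hq80 : 80 ≤ q := Real.le_sqrt_of_sq_le (by linarith)
  have hint : Integrable (fun u : ℝ => u ^ 4) (gaussianReal 0 1) := by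
    have := (memLp_id_gaussianReal (μ := 0) (v := 1) 4).integrable_norm_pow (p := 4) (by norm_num)
    refine this.congr (ae_of_all _ fun u => ?_)
    simp only [id, Real.norm_eq_abs]
    exact Even.pow_abs (by decide) u
  have hmarkov := mul_meas_ge_le_integral_of_nonneg (ae_of_all (gaussianReal 0 1)
    fun u : ℝ => (by positivity : 0 ≤ u ^ 4)) hint q
  rw [le_div_iff₀ hq0, mul_comm]
  refine le_trans (mul_le_mul_of_nonneg_left ?_ hq0.le) hmarkov
  rw [latticeGaussian, map_measureReal_apply (measurable_lattice n) MeasurableSet.of_discrete]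
  refine measureReal_mono fun u hu => ?_
  simp only [Set.mem_preimage, Set.mem_compl_iff, SetLike.mem_coe] at hu
  set k := ⌊4 / 5 * n + 2 / 5 * √(n : ℝ) * u⌋ with hk
  have h1 : (n : ℝ) ^ 2 < |(k : ℝ) - 4 / 5 * n| ^ 3 := by
    by_contra h
    exact hu (mem_window hn (not_lt.1 h))
  have h2 := sqrt_pow_five_le (by omega) h1
  have h3 : |(k : ℝ) - 4 / 5 * n| ≤ 2 / 5 * q * |u| + 1 := by
    have f1 := Int.floor_le (4 / 5 * n + 2 / 5 * √(n : ℝ) * u)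
    have f2 := Int.lt_floor_add_one (4 / 5 * n + 2 / 5 * √(n : ℝ) * u)
    rw [← hk, ← hq] at f1 f2
    have f3 : |2 / 5 * q * u| = 2 / 5 * q * |u| := by
      rw [abs_mul, abs_of_nonneg (by positivity)]
    have f4 := abs_le.1 f3.le
    rw [abs_le]
    constructor <;> linarith
  have h4 : q ^ 5 ≤ (2 / 5 * q * |u| + 1) ^ 4 :=
    h2.trans (pow_le_pow_left₀ (abs_nonneg _) h3 4)
  have h5 : ∀ a : ℝ, (a + 1) ^ 4 ≤ 8 * (a ^ 4 + 1) := fun a => by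
    nlinarith [sq_nonneg (a ^ 2 - 1), sq_nonneg (a - 1), sq_nonneg (a * (a - 1)),
      sq_nonneg ((a - 1) * (a - 1)), sq_nonneg ((a - 1) * (a + 1))]
  have h6 := h4.trans (h5 _)
  have h7 : (2 / 5 * q * |u|) ^ 4 = 16 / 625 * q ^ 4 * u ^ 4 := by
    rw [mul_pow, Even.pow_abs (by decide)]
    ring
  rw [h7] at h6
  have h8 : 16 ≤ q ^ 4 := by
    calc (16 : ℝ) ≤ 80 ^ 4 := by norm_num
      _ ≤ q ^ 4 := pow_le_pow_left₀ (by norm_num) hq80 4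
  have h9 : q ^ 4 * q ≤ q ^ 4 * (128 / 625 * u ^ 4 + 1) := by nlinarith
  have h10 := le_of_mul_le_mul_left h9 (by positivity)
  show q ≤ u ^ 4
  nlinarith

/-- The total variation distance between the law of the number of vertices and the discretized
Gaussian law is `O(1 / √n)`. -/
theorem exists_local_comparison : ∃ C : ℝ, ∃ N : ℕ, ∀ n ≥ N,
    |amplitude n - 1| ≤ C / √(n : ℝ) ∧
      ∀ S : Set ℤ, |(vertexLaw n).real S - (latticeGaussian n).real S| ≤ C / √(n : ℝ) := by
  set C : ℝ := 80 * Real.exp 800 * 220 + 100 + fourthMoment with hC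
  have hM : 0 ≤ fourthMoment := integral_nonneg fun u => by positivity
  have hC1 : 80 * Real.exp 800 * 220 ≤ C := by linarith
  have hC2 : 100 ≤ C := by
    have := Real.exp_pos 800
    linarith
  have hC3 : fourthMoment ≤ C := by
    have := Real.exp_pos 800
    linarith
  refine ⟨7 * C, max 8000 ⌈(4 * C) ^ 2⌉₊, fun n hn => ?_⟩
  have hn1 : 8000 ≤ n := (le_max_left _ _).trans hn
  have hn2 : (4 * C) ^ 2 ≤ n := Nat.ceil_le.1 ((le_max_right _ _).trans hn)
  have hq0 : 0 < √(n : ℝ) := Real.sqrt_pos.2 (by positivity)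
  have hq : 4 * C ≤ √(n : ℝ) := Real.le_sqrt_of_sq_le hn2
  have hsum : ∑ k ∈ window n, |(vertexLaw n).real {k} -
      amplitude n * (latticeGaussian n).real {k}| ≤ C / √(n : ℝ) := by
    have h1 : ∑ k ∈ window n, |(vertexLaw n).real {k} -
        amplitude n * (latticeGaussian n).real {k}| ≤
        80 * Real.exp 800 * expect n (fun k => localError n (k - 4 / 5 * n)) := by
      rw [window, Finset.sum_map, expect_apply, Finset.mul_sum]
      refine (Finset.sum_le_sum (g := fun k : ℕ => 80 * Real.exp 800 *
        (weight n k * localError n (k - 4 / 5 * n))) fun k hk => ?_).trans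
        (Finset.sum_le_sum_of_subset_of_nonneg (Finset.filter_subset _ _) fun k _ _ => ?_)
      · rw [Finset.mem_filter, Finset.mem_Icc] at hk
        have := abs_weight_sub_le hn1 hk.1.1 hk.1.2 hk.2
        rwa [← vertexLaw_singleton] at this ⊢
      · exact mul_nonneg (by positivity) (mul_nonneg (weight_nonneg _ _) (localError_nonneg _ _))
    refine h1.trans ?_
    refine (mul_le_mul_of_nonneg_left (expect_localError_le (by omega)) (by positivity)).trans ?_
    rw [mul_div_assoc']
    gcongr
  have := abs_measureReal_sub_le_of_local (amplitude_nonneg n)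
    (by rw [div_le_iff₀ hq0]; linarith) hsum
    ((vertexLaw_compl_window_le (by omega)).trans (by gcongr))
    ((latticeGaussian_compl_window_le hn1).trans (by gcongr))
  have hpos : 0 ≤ C / √(n : ℝ) := by positivity
  rw [mul_div_assoc]
  exact ⟨by linarith [this.1], this.2⟩

end MultiEdgeTree

/-! ### The central and local limit theorems -/

namespace MultiEdgeTree

theorem gaussianReal_Iic (v : ℝ) : (gaussianReal 0 1).real (Set.Iic v) =
    1 / √(2 * Real.pi) * ∫ t in Set.Iic v, Real.exp (-t ^ 2 / 2) := by
  rw [Measure.real, gaussianReal_apply_eq_integral 0 one_ne_zero, ENNReal.toReal_ofReal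
    (integral_nonneg fun u => gaussianPDFReal_nonneg _ _ _), ← integral_const_mul]
  refine setIntegral_congr_fun measurableSet_Iic fun t _ => ?_
  simp [gaussianPDFReal]

/-- Rounding a Gaussian variable of standard deviation `2 / 5 * √n` to an integer changes its
distribution function by `O(1 / √n)`. -/
theorem abs_latticeGaussian_sub_le {n : ℕ} (hn : 1 ≤ n) (v : ℝ) :
    |(latticeGaussian n).real {k | (k : ℝ) + 1 ≤ 4 / 5 * n + 2 / 5 * √(n : ℝ) * v} -
      (gaussianReal 0 1).real (Set.Iic v)| ≤ 3 / √(n : ℝ) := by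
  have hq0 : 0 < √(n : ℝ) := Real.sqrt_pos.2 (by exact_mod_cast hn)
  set σ := 2 / 5 * √(n : ℝ) with hσ
  have hσ0 : 0 < σ := by positivity
  rw [latticeGaussian, map_measureReal_apply (measurable_lattice n) MeasurableSet.of_discrete]
  set S := (fun u : ℝ => ⌊4 / 5 * n + 2 / 5 * √(n : ℝ) * u⌋) ⁻¹'
    {k | (k : ℝ) + 1 ≤ 4 / 5 * n + σ * v} with hS
  have h1 : S ⊆ Set.Iic v := by
    intro u hu
    simp only [hS, Set.mem_preimage, Set.mem_ofPred_eq] at hu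
    have := Int.lt_floor_add_one (4 / 5 * n + 2 / 5 * √(n : ℝ) * u)
    rw [← hσ] at hu this
    exact le_of_mul_le_mul_left (by linarith : σ * u ≤ σ * v) hσ0
  have h2 : Set.Iic v ⊆ S ∪ Set.Ico (v - 1 / σ) v ∪ {v} := by
    intro u hu
    rcases eq_or_lt_of_le (Set.mem_Iic.1 hu) with rfl | hlt
    · exact Or.inr rfl
    rcases le_or_gt (v - 1 / σ) u with h | h
    · exact Or.inl (Or.inr ⟨h, hlt⟩)
    · refine Or.inl (Or.inl ?_)
      simp only [hS, Set.mem_preimage, Set.mem_ofPred_eq]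
      have := Int.floor_le (4 / 5 * n + 2 / 5 * √(n : ℝ) * u)
      rw [← hσ] at this ⊢
      have h3 : σ * u < σ * (v - 1 / σ) := mul_lt_mul_of_pos_left h hσ0
      have h4 : σ * (v - 1 / σ) = σ * v - 1 := by field_simp
      linarith
  have hpdf : ∀ u, 0 ≤ gaussianPDFReal 0 1 u ∧ gaussianPDFReal 0 1 u ≤ 1 := by
    intro u
    refine ⟨gaussianPDFReal_nonneg _ _ _, ?_⟩
    rw [gaussianPDFReal]
    have h1 : 1 ≤ √(2 * Real.pi * ((1 : NNReal) : ℝ)) := by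
      rw [Real.one_le_sqrt, NNReal.coe_one]
      linarith [Real.pi_gt_three]
    refine mul_le_one₀ (inv_le_one_of_one_le₀ h1) (Real.exp_pos _).le (Real.exp_le_one_iff.2 ?_)
    simp only [sub_zero]
    have := sq_nonneg u
    simp
    linarith
  have h3 := (gaussianReal_Ico_bounds (a := v - 1 / σ) (b := v) (L := 0) (U := 1)
    (by have : 0 ≤ 1 / σ := by positivity
        linarith) fun u _ => hpdf u).2
  have h4 : (gaussianReal 0 1).real {v} = 0 := by
    have := nullSingletonClass_gaussianReal (μ := 0) (v := 1) one_ne_zero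
    simp [Measure.real]
  have h5 : (gaussianReal 0 1).real (Set.Iic v) ≤
      (gaussianReal 0 1).real S + (gaussianReal 0 1).real (Set.Ico (v - 1 / σ) v) + 0 := by
    refine (measureReal_mono h2).trans ((measureReal_union_le _ _).trans ?_)
    exact add_le_add (measureReal_union_le _ _) h4.le
  have h6 := measureReal_mono (μ := gaussianReal 0 1) h1
  have h7 : 1 / σ ≤ 3 / √(n : ℝ) := by
    rw [div_le_div_iff₀ hσ0 hq0]
    linarith
  have h8 : 0 ≤ 3 / √(n : ℝ) := by positivity
  rw [abs_le]
  constructor <;> linarith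

theorem berry_esseen_vertices : ∃ C : ℝ, ∀ n : ℕ, 1 ≤ n → ∀ v : ℝ,
      |(MultiEdgeTree.uniformTree n).real
            {t | ((t.vertices : ℝ) - 4 / 5 * (n : ℝ)) / (2 / 5 * √(n : ℝ)) ≤ v}
          - 1 / √(2 * Real.pi) * ∫ t in Set.Iic v, Real.exp (-t ^ 2 / 2)| ≤ C / √(n : ℝ) := by
  obtain ⟨C, N, h⟩ := exists_local_comparison
  refine ⟨max (C + 3) √(N : ℝ), fun n hn v => ?_⟩
  have hq0 : 0 < √(n : ℝ) := Real.sqrt_pos.2 (by exact_mod_cast hn)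
  rw [← gaussianReal_Iic]
  rcases le_or_gt N n with hN | hN
  · have h1 := (h n hN).2 {k | (k : ℝ) + 1 ≤ 4 / 5 * n + 2 / 5 * √(n : ℝ) * v}
    have h2 := abs_latticeGaussian_sub_le hn v
    have e : (uniformTree n).real
        {t | ((t.vertices : ℝ) - 4 / 5 * (n : ℝ)) / (2 / 5 * √(n : ℝ)) ≤ v} =
        (vertexLaw n).real {k | (k : ℝ) + 1 ≤ 4 / 5 * n + 2 / 5 * √(n : ℝ) * v} := by
      rw [vertexLaw, map_measureReal_apply Measurable.of_discrete MeasurableSet.of_discrete]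
      congr 1
      ext t
      simp only [Set.mem_preimage, Set.mem_ofPred_eq]
      rw [div_le_iff₀ (by positivity)]
      push_cast
      constructor <;> intro h <;> linarith
    rw [e]
    refine (abs_sub_le _ _ _).trans ((add_le_add h1 h2).trans ?_)
    rw [← add_div]
    gcongr
    exact le_max_left _ _
  · -- for the finitely many remaining `n` the bound is at least `1`
    have h1 : (1 : ℝ) ≤ max (C + 3) √(N : ℝ) / √(n : ℝ) := by
      rw [one_le_div hq0]
      refine le_trans (Real.sqrt_le_sqrt ?_) (le_max_right _ _)
      exact_mod_cast hN.le
    refine le_trans ?_ h1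
    exact abs_sub_le_of_nonneg_of_le measureReal_nonneg measureReal_le_one measureReal_nonneg
      measureReal_le_one

theorem tendsto_amplitude : Tendsto amplitude atTop (nhds 1) := by
  obtain ⟨C, N, h⟩ := exists_local_comparison
  rw [tendsto_iff_norm_sub_tendsto_zero]
  refine squeeze_zero' (Eventually.of_forall fun _ => norm_nonneg _)
    (eventually_atTop.2 ⟨N, fun n hn => (h n hn).1⟩) ?_
  exact tendsto_const_nhds.div_atTop
    (Real.tendsto_sqrt_atTop.comp tendsto_natCast_atTop_atTop)

theorem one_isLittleO_rpow :
    (fun _ : ℕ => (1 : ℝ)) =o[atTop] fun n : ℕ => (n : ℝ) ^ (2 / 3 : ℝ) := by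
  rw [isLittleO_const_left]
  right
  refine tendsto_norm_atTop_atTop.comp ?_
  exact (tendsto_rpow_atTop (by norm_num)).comp tendsto_natCast_atTop_atTop

theorem tendsto_localError {y : ℕ → ℝ}
    (hy : y =o[atTop] fun n : ℕ => (n : ℝ) ^ (2 / 3 : ℝ)) :
    Tendsto (fun n => (|y n| + 1) / n) atTop (nhds 0) ∧
      Tendsto (fun n => localError n (y n)) atTop (nhds 0) := by
  have h1 : (fun n => |y n| + 1) =o[atTop] fun n : ℕ => (n : ℝ) ^ (2 / 3 : ℝ) :=
    hy.abs_left.add one_isLittleO_rpow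
  have h2 : (fun n => |y n| + 1) =o[atTop] fun n : ℕ => (n : ℝ) := by
    refine h1.trans_isBigO (IsBigO.of_bound 1 ?_)
    filter_upwards [eventually_ge_atTop 1] with n hn
    have hn' : (1 : ℝ) ≤ n := by exact_mod_cast hn
    rw [one_mul, Real.norm_of_nonneg (by positivity), Real.norm_of_nonneg (by positivity)]
    calc (n : ℝ) ^ (2 / 3 : ℝ) ≤ (n : ℝ) ^ (1 : ℝ) :=
          Real.rpow_le_rpow_of_exponent_le hn' (by norm_num)
      _ = n := Real.rpow_one _
  have h3 : (fun n => (|y n| + 1) ^ 3) =o[atTop] fun n : ℕ => (n : ℝ) ^ 2 := by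
    refine (h1.pow (n := 3) (by norm_num)).congr_right fun n => ?_
    rw [← Real.rpow_natCast, ← Real.rpow_mul (by positivity)]
    norm_num
  refine ⟨h2.tendsto_div_nhds_zero, ?_⟩
  simpa [localError] using h2.tendsto_div_nhds_zero.add h3.tendsto_div_nhds_zero

theorem local_limit_vertices (k : ℕ → ℕ)
    (hk : (fun n : ℕ => (k n : ℝ) - 4 / 5 * (n : ℝ)) =o[atTop]
      fun n : ℕ => (n : ℝ) ^ (2 / 3 : ℝ)) :
    (fun n : ℕ => (MultiEdgeTree.uniformTree n).real {t | t.vertices = k n}) ~[atTop]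
        fun n : ℕ => 5 / (2 * √(2 * (n : ℝ) * Real.pi)) *
          Real.exp (-(1 / 2) *
            (((k n : ℝ) - 4 / 5 * (n : ℝ)) / (2 / 5 * √(n : ℝ))) ^ 2) := by
  set y : ℕ → ℝ := fun n => (k n : ℝ) - 4 / 5 * n - 1 with hy
  have hyo : y =o[atTop] fun n : ℕ => (n : ℝ) ^ (2 / 3 : ℝ) := hk.sub one_isLittleO_rpow
  obtain ⟨t1, t2⟩ := tendsto_localError hyo
  have hev : ∀ᶠ n : ℕ in atTop, 20 ≤ n ∧ |y n| ≤ n / 20 := by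
    filter_upwards [eventually_ge_atTop 20,
      t1.eventually (ge_mem_nhds (by norm_num : (0 : ℝ) < 1 / 20))] with n hn h
    have hn' : (20 : ℝ) ≤ n := by exact_mod_cast hn
    rw [div_le_iff₀ (by linarith)] at h
    exact ⟨hn, by linarith⟩
  refine isEquivalent_of_tendsto_one ?_
  have e1 : Tendsto (fun n => logRatio n (k n - 1) - logRatio n (centre n)) atTop (nhds 0) := by
    refine squeeze_zero_norm' ?_ (by simpa using t2.const_mul 70)
    filter_upwards [hev] with n ⟨hn, h⟩
    have hn' : (20 : ℝ) ≤ n := by exact_mod_cast hn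
    have hk' : (k n : ℝ) = 4 / 5 * n + y n + 1 := by rw [hy]; ring
    have h1 : 1 ≤ k n := by
      have : (0 : ℝ) < k n := by linarith [(abs_le.1 h).1]
      exact_mod_cast this
    have h2 : ((k n - 1 : ℕ) : ℝ) - 4 / 5 * n = y n := by
      rw [Nat.cast_sub h1, hy]
      push_cast
      ring
    rw [← h2] at h ⊢
    exact abs_logRatio_sub_centre_le hn h
  have e2 : Tendsto (fun n : ℕ => 25 / (8 * (n : ℝ)) * (2 * y n + 1)) atTop (nhds 0) := by
    refine squeeze_zero_norm' (Eventually.of_forall fun n => ?_) (by simpa using t1.const_mul 7)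
    rw [Real.norm_eq_abs, abs_mul, abs_of_nonneg (by positivity)]
    have h1 : |2 * y n + 1| ≤ 2 * (|y n| + 1) := by
      refine (abs_add_le _ _).trans ?_
      rw [abs_mul, abs_two, abs_one]
      linarith
    refine (mul_le_mul_of_nonneg_left h1 (by positivity)).trans ?_
    have h2 : 0 ≤ (|y n| + 1) / n := by positivity
    have h3 : 25 / (8 * (n : ℝ)) * (2 * (|y n| + 1)) = 25 / 4 * ((|y n| + 1) / n) := by
      rw [← div_div, div_mul_eq_mul_div, mul_div_assoc']
      ring
    rw [h3]
    linarith
  have e3 := tendsto_amplitude.mul ((Real.continuous_exp.tendsto _).comp (e1.add e2))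
  simp only [add_zero, Real.exp_zero, mul_one] at e3
  refine e3.congr' ?_
  filter_upwards [hev] with n ⟨hn, h⟩
  have hn' : (20 : ℝ) ≤ n := by exact_mod_cast hn
  obtain ⟨ha, hb⟩ := abs_le.1 h
  have h5 : (k n : ℝ) - 4 / 5 * n = y n + 1 := by rw [hy]; ring
  have h1 : 2 ≤ k n := by
    have : (1 : ℝ) < k n := by linarith
    exact_mod_cast this
  have h2 : k n - 1 ≤ n := by
    have : (k n : ℝ) ≤ n + 1 := by linarith
    have : k n ≤ n + 1 := by exact_mod_cast this
    omega
  have h3 : ((k n - 1 : ℕ) : ℝ) - 4 / 5 * n = y n := by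
    rw [Nat.cast_sub (by omega), hy]
    push_cast
    ring
  have h4 : (uniformTree n).real {t | t.vertices = k n} = weight n (k n - 1) := by
    rw [weight, Nat.sub_add_cancel (by omega)]
  have hq0 : 0 < √(n : ℝ) := Real.sqrt_pos.2 (by linarith)
  have hq2 : √(n : ℝ) ^ 2 = n := Real.sq_sqrt (by linarith)
  have hs : √(2 * (n : ℝ) * Real.pi) = √(2 * Real.pi) * √(n : ℝ) := by
    rw [← Real.sqrt_mul (by positivity)]
    congr 1
    ring
  have hp : 0 < √(2 * Real.pi) := Real.sqrt_pos.2 (by positivity)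
  have h6 : -(1 / 2) * ((y n + 1) / (2 / 5 * √(n : ℝ))) ^ 2 = -(25 / (8 * n)) * (y n + 1) ^ 2 := by
    rw [div_pow, mul_pow, hq2]
    field_simp
    ring
  simp only [Pi.div_apply, Function.comp_apply]
  rw [h4, weight_eq_exp (by omega) h2, h3, h5, h6, hs, amplitude, eq_div_iff (by positivity)]
  have h7 : ∀ a b c : ℝ, Real.exp a * (√(2 * Real.pi) * (2 / 5 * √(n : ℝ))) * Real.exp b *
      (5 / (2 * (√(2 * Real.pi) * √(n : ℝ))) * Real.exp c) = Real.exp (a + b + c) := by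
    intro a b c
    rw [Real.exp_add, Real.exp_add]
    field_simp
  rw [h7]
  congr 1
  field_simp
  ring

end MultiEdgeTree
theorem mainTheorem3 :
    ((fun n : ℕ => (∫ t, (t.vertices : ℝ) ∂(MultiEdgeTree.uniformTree n))
        - (4 / 5 * (n : ℝ) + 9 / 10)) =O[atTop] fun n : ℕ => 1 / (n : ℝ)) ∧
    ((fun n : ℕ => variance (fun t : MultiEdgeTree => (t.vertices : ℝ))
          (MultiEdgeTree.uniformTree n)
        - (4 / 25 * (n : ℝ) + 2 / 25)) =O[atTop] fun n : ℕ => 1 / (n : ℝ)) ∧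
    (∃ C : ℝ, ∀ n : ℕ, 1 ≤ n → ∀ v : ℝ,
      |(MultiEdgeTree.uniformTree n).real
            {t | ((t.vertices : ℝ) - 4 / 5 * (n : ℝ)) / (2 / 5 * √(n : ℝ)) ≤ v}
          - 1 / √(2 * Real.pi) * ∫ t in Set.Iic v, Real.exp (-t ^ 2 / 2)| ≤ C / √(n : ℝ)) ∧
    (∀ k : ℕ → ℕ,
      ((fun n : ℕ => (k n : ℝ) - 4 / 5 * (n : ℝ)) =o[atTop]
        fun n : ℕ => (n : ℝ) ^ (2 / 3 : ℝ)) →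
      (fun n : ℕ => (MultiEdgeTree.uniformTree n).real {t | t.vertices = k n}) ~[atTop]
        fun n : ℕ => 5 / (2 * √(2 * (n : ℝ) * Real.pi)) *
          Real.exp (-(1 / 2) *
            (((k n : ℝ) - 4 / 5 * (n : ℝ)) / (2 / 5 * √(n : ℝ))) ^ 2)) := by
  refine ⟨IsBigO.of_bound 2 ?_, IsBigO.of_bound 20 ?_, MultiEdgeTree.berry_esseen_vertices,
    MultiEdgeTree.local_limit_vertices⟩
  · filter_upwards [eventually_ge_atTop 1] with n hn
    rw [Real.norm_eq_abs, Real.norm_of_nonneg (by positivity)]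
    exact MultiEdgeTree.integral_vertices_bound hn
  · filter_upwards [eventually_ge_atTop 1] with n hn
    rw [Real.norm_eq_abs, Real.norm_of_nonneg (by positivity)]
    exact MultiEdgeTree.variance_vertices_bound hn
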